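/- **Lemma 2.1.** Throughout, graphs are finite and simple, and $d(v)$ denotes the degree of $v$. *Quasi-perfect matchings.* Let $G$ be a graph with an even number of vertices. A quasi-perfect matching $\mathbb M$ of $G$ is a partition of $V(G)$ into pairs obtained from the edges of a maximum matching of $G$ by splitting the vertices not covered by it arbitrarily into pairs. Write $v'$ for the vertex paired with $v$ in $\mathbb M$. *Two-stage algorithm.* Given $G$ and $\mathbb M$, for each pair $vv'\in\mathbb M$ choose, independently and with probability $1/2$ each, either $h(v)=0,\ h(v')=1$ or $h(v)=1,\ h(v')=0$. For $i\in\{0,1\}$ let $N_i(v)$ be the set of neighbours $w\ne v'$ of $v$ in $G$ with $h(w)=i$, and put $$\sigma(vv')=|N_{1-h(v)}(v)|+|N_{1-h(v')}(v')|-|N_{h(v)}(v)|-|N_{h(v')}(v')|.$$ For each pair with $\sigma(vv')<0$ choose again, independently and with probability $1/2$ each, either $h'(v)=0,\ h'(v')=1$ or $h'(v)=1,\ h'(v')=0$; for each pair with $\sigma(vv')\ge 0$ put $h'(v)=h(v)$, $h'(v')=h(v')$. The output is the bisection $(V_0,V_1)$ with $V_i=\{v: h'(v)=i\}$. *Claim.*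 There is an absolute constant $\varepsilon>0$ such that every graph $G$ that contains neither $C_4$ nor $C_6$ as a (not necessarily induced) subgraph, has an even number of vertices and has minimum degree at least $2$, has a quasi-perfect matching $\mathbb M$ with the following property. Let $(V_0,V_1)$ be the random bisection produced by the two-stage algorithm from $G$ and $\mathbb M$. For every edge $uv$ of $G$ with $uv\notin\mathbb M$ that is the only edge of $G$ between $\{u,u'\}$ and $\{v,v'\}$, the probability that $u$ and $v$ lie in different parts of $(V_0,V_1)$ is at least $$\frac12+\varepsilon\left(\frac1{\sqrt{d(u)+d(u')}}+\frac1{\sqrt{d(v)+d(v')}}\right).$$ -/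

import Mathlib

namespace MaxBisection

/-- A maximum matching of `G`: a matching of `G` with the largest possible number of edges
(used for finite graphs only). -/
def IsMaximumMatching {V : Type*} (G : SimpleGraph V) (M : G.Subgraph) : Prop :=
  M.IsMatching ∧ ∀ M' : G.Subgraph, M'.IsMatching → M'.edgeSet.ncard ≤ M.edgeSet.ncard

/-- A quasi-perfect matching of `G`: a partition of the whole vertex set into pairs, given by the
involution `mate` that sends `v` to the other vertex `v'` of its pair, which contains all edges of
some maximum matching of `G`. The remaining pairs then form an arbitrary partition into pairs of
the set of vertices missed by this maximum matching. -/
structure QuasiPerfectMatching {V : Type*} (G : SimpleGraph V) where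
  /-- the partner `v'` of `v` -/
  mate : V → V
  mate_mate : ∀ v, mate (mate v) = v
  mate_ne : ∀ v, mate v ≠ v
  extends_maximum : ∃ M : G.Subgraph, IsMaximumMatching G M ∧ ∀ v w, M.Adj v w → mate v = w

namespace QuasiPerfectMatching

/-- The labelings `h : V → {0, 1}` (with `0 = false`, `1 = true`) that give the two vertices of
each pair different labels. Such an `h` is the bisection `(h⁻¹(0), h⁻¹(1))`. -/
abbrev Splitting {V : Type*} {G : SimpleGraph V} (M : QuasiPerfectMatching G) : Type _ :=
  {h : V → Bool // ∀ v, h (M.mate v) = !h v}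

theorem splitting_nonempty {V : Type*} [Fintype V] {G : SimpleGraph V}
    (M : QuasiPerfectMatching G) : Nonempty M.Splitting := by
  classical
  let e := Fintype.equivFin V
  refine ⟨⟨fun v => decide (e v < e (M.mate v)), fun v => ?_⟩⟩
  have hne : e (M.mate v) ≠ e v := fun h => M.mate_ne v (e.injective h)
  simp only [M.mate_mate]
  rcases lt_or_gt_of_ne hne with h | h
  · simp [h, h.le]
  · simp [h, h.le]

instance {V : Type*} [Fintype V] {G : SimpleGraph V} (M : QuasiPerfectMatching G) :
    Nonempty M.Splitting := M.splitting_nonempty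

/-- `N_i(v)`: the neighbours of `v` in `G`, other than the partner of `v`, that have label `i`. -/
def labelNbrs {V : Type*} [Fintype V] [DecidableEq V] {G : SimpleGraph V} [DecidableRel G.Adj]
    (M : QuasiPerfectMatching G) (h : V → Bool) (i : Bool) (v : V) : Finset V :=
  {w ∈ G.neighborFinset v | w ≠ M.mate v ∧ h w = i}

/-- `σ(vv') = |N_{1-h(v)}(v)| + |N_{1-h(v')}(v')| - |N_{h(v)}(v)| - |N_{h(v')}(v')|`. -/
def sigma {V : Type*} [Fintype V] [DecidableEq V] {G : SimpleGraph V} [DecidableRel G.Adj]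
    (M : QuasiPerfectMatching G) (h : V → Bool) (v : V) : ℤ :=
  ((M.labelNbrs h (!h v) v).card : ℤ)
    + ((M.labelNbrs h (!h (M.mate v)) (M.mate v)).card : ℤ)
    - ((M.labelNbrs h (h v) v).card : ℤ)
    - ((M.labelNbrs h (h (M.mate v)) (M.mate v)).card : ℤ)

theorem sigma_mate {V : Type*} [Fintype V] [DecidableEq V] {G : SimpleGraph V}
    [DecidableRel G.Adj] (M : QuasiPerfectMatching G) (h : V → Bool) (v : V) :
    M.sigma h (M.mate v) = M.sigma h v := by
  simp only [sigma, M.mate_mate]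
  ring

/-- The second labeling `h'`, computed from the first labeling `h` and from fresh choices `g`:
active pairs (`σ(vv') < 0` under `h`) receive the fresh choice, stable pairs keep their labels. -/
def relabel {V : Type*} [Fintype V] [DecidableEq V] {G : SimpleGraph V} [DecidableRel G.Adj]
    (M : QuasiPerfectMatching G) (h g : M.Splitting) : M.Splitting :=
  ⟨fun v => if M.sigma h.1 v < 0 then g.1 v else h.1 v, fun v => by
    simp only [sigma_mate, h.2, g.2]
    split_ifs <;> rfl⟩

/-- One independent fair choice, for each pair `vv'`, between `h(v) = 0, h(v') = 1` and
`h(v) = 1, h(v') = 0`; that is, the uniform distribution on the product of these two-element sets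
of choices. -/
noncomputable def fairChoices {V : Type*} [Fintype V] [DecidableEq V] {G : SimpleGraph V}
    (M : QuasiPerfectMatching G) : PMF M.Splitting :=
  PMF.uniformOfFintype M.Splitting

/-- The law of the labeling `h'` returned by the two-stage random algorithm: draw `h`, then draw
independent fresh choices and use them on the pairs that are active under `h`. -/
noncomputable def twoStage {V : Type*} [Fintype V] [DecidableEq V] {G : SimpleGraph V}
    [DecidableRel G.Adj] (M : QuasiPerfectMatching G) : PMF M.Splitting :=
  M.fairChoices.bind fun h => M.fairChoices.map fun g => M.relabel h g

/-- The probability that `u` and `v` lie in different parts of the random bisection returned by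
the two-stage random algorithm. -/
noncomputable def cutProb {V : Type*} [Fintype V] [DecidableEq V] {G : SimpleGraph V}
    [DecidableRel G.Adj] (M : QuasiPerfectMatching G) (u v : V) : ℝ :=
  M.twoStage.toMeasure.real {h' | h'.1 u ≠ h'.1 v}

end QuasiPerfectMatching

end MaxBisection

/-! ### Random labels: simple walk, central binomial bound, Harris' inequality. -/

namespace MaxBisection

open Finset
open scoped BigOperators

/-! Fix an edge `uv` that is the only one between its two pairs. If one of the pairs is active, its
fresh fair choice cuts `uv` with probability exactly 1/2, so only labelings with both pairs stable
matter. Let A and B be the signed contributions of all other pairs to the two values of σ. Running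
through the labels of u and v, the cut probability is 1/2 + (P(A ≤ 1, B ≥ -1) - P(A ≤ -1, B ≤ -1))/4
(`expect_cut_eq`), where A and B are sums of the same independent signs with coefficients 0, ±1.

If no sign had the same nonzero coefficient in A and B, Harris' inequality would bound the
difference below by F(1)G(1) - F(-1)G(-1), with F and G the distribution functions of A and B. The
excess F(1) - 1/2 = P(|A| ≤ 1)/2 is at least of order 1/√(d(u)+d(u')), by the central binomial
coefficient; likewise for G. Signs with equal coefficients work against this, but if there are at
most five, conditioning on their sum (a simple walk) retains a fixed fraction of the gain
(`walkAvg_cut_excess_ge`).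

That there are at most five (`card_le_five`) is the combinatorial part. Such a pair contains a
common neighbour of u and v, or of u' and v' (one of each, as there is no C₄), or is joined
crosswise: r to u' and r' to v, or r to v' and r' to u. Among matched pairs, two crosswise ones of
the same orientation close a C₆. For unmatched pairs the quasi-perfect matching is chosen so that as
many vertices as possible share a neighbour with their mate; then two unmatched crosswise pairs
yield a C₆ or an augmenting path. -/

/-- The indicator of a proposition, as a real number. -/
noncomputable def ind (p : Prop) : ℝ := open Classical in if p then 1 else 0

theorem ind_of {p : Prop} (h : p) : ind p = 1 := by simp [ind, h]

theorem ind_of_not {p : Prop} (h : ¬p) : ind p = 0 := by simp [ind, h]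

theorem ind_nonneg (p : Prop) : 0 ≤ ind p := by unfold ind; split_ifs <;> norm_num

theorem ind_le_one (p : Prop) : ind p ≤ 1 := by unfold ind; split_ifs <;> norm_num

theorem ind_and (p q : Prop) : ind (p ∧ q) = ind p * ind q := by
  by_cases hp : p <;> by_cases hq : q <;> simp [ind, hp, hq]

theorem ind_not (p : Prop) : ind (¬p) = 1 - ind p := by
  by_cases hp : p <;> simp [ind, hp]

theorem ind_mono {p q : Prop} (h : p → q) : ind p ≤ ind q := by
  by_cases hp : p
  · rw [ind_of hp, ind_of (h hp)]
  · rw [ind_of_not hp]; exact ind_nonneg q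

theorem ind_congr {p q : Prop} (h : p ↔ q) : ind p = ind q := by rw [propext h]

/-- The label `true` counts as `1`, the label `false` as `-1`. -/
def boolSign (b : Bool) : ℤ := if b then 1 else -1

@[simp] theorem boolSign_true : boolSign true = 1 := rfl

@[simp] theorem boolSign_false : boolSign false = -1 := rfl

@[simp] theorem boolSign_not (b : Bool) : boolSign (!b) = -boolSign b := by cases b <;> rfl

theorem boolSign_mono {b c : Bool} (h : b ≤ c) : boolSign b ≤ boolSign c := by
  revert h; cases b <;> cases c <;> decide

/-- The signed sum of the labels `x i` over `i ∈ s` with coefficients `c`. -/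
def signSum {ι : Type*} (s : Finset ι) (c : ι → ℤ) (x : ι → Bool) : ℤ := ∑ i ∈ s, c i * boolSign (x i)

theorem signSum_update {ι : Type*} [DecidableEq ι] {s : Finset ι} {c : ι → ℤ} {x : ι → Bool} {i : ι} {b : Bool}
    (hi : i ∉ s) : signSum s c (Function.update x i b) = signSum s c x := by
  refine Finset.sum_congr rfl fun j hj => ?_
  rw [Function.update_of_ne (by rintro rfl; exact hi hj)]

theorem signSum_compl {ι : Type*} (s : Finset ι) (c : ι → ℤ) (x : ι → Bool) :
    signSum s c (fun i => !x i) = -signSum s c x := by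
  simp [signSum, Finset.sum_neg_distrib]

section Cube

variable {ι : Type*} [Fintype ι] [DecidableEq ι]

/-- Complementing the labels of the `i` with `p i`, as a permutation of the cube. -/
def cubeFlip (p : ι → Bool) : (ι → Bool) ≃ (ι → Bool) where
  toFun x i := xor (p i) (x i)
  invFun x i := xor (p i) (x i)
  left_inv x := by funext i; simp
  right_inv x := by funext i; simp

theorem expect_compl (f : (ι → Bool) → ℝ) :
    (𝔼 x : ι → Bool, f fun i => !x i) = 𝔼 x : ι → Bool, f x := by
  refine Fintype.expect_equiv (cubeFlip fun _ => true) _ _ fun x => ?_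
  simp [cubeFlip]

theorem expect_eq_expect_update (i : ι) (f : (ι → Bool) → ℝ) :
    𝔼 x, f x
      = 𝔼 x, (f (Function.update x i true) + f (Function.update x i false)) / 2 := by
  have h1 : 𝔼 x : ι → Bool, f (Function.update x i (!x i)) = 𝔼 x, f x := by
    refine Fintype.expect_equiv (cubeFlip fun j => decide (j = i)) _ _ fun x => ?_
    congr 1
    funext j
    by_cases h : j = i
    · subst h; simp [cubeFlip]
    · simp [cubeFlip, h]
  have h2 : 𝔼 x : ι → Bool, (f x + f (Function.update x i (!x i))) / 2 = 𝔼 x, f x := by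
    rw [← Finset.expect_div, Finset.expect_add_distrib, h1]
    ring
  rw [← h2]
  refine Finset.expect_congr rfl fun x _ => ?_
  congr 1
  cases hx : x i
  · rw [add_comm, Bool.not_false, ← hx, Function.update_eq_self]
  · rw [Bool.not_true]
    nth_rw 1 [← Function.update_eq_self i x]
    rw [hx]

/-- The average of `ψ` under the law of a sum of `n` independent random signs. -/
noncomputable def walkAvg : ℕ → (ℤ → ℝ) → ℝ
  | 0, ψ => ψ 0
  | n + 1, ψ => (walkAvg n (fun z => ψ (z + 1)) + walkAvg n (fun z => ψ (z - 1))) / 2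

theorem walkAvg_mono {n : ℕ} {ψ χ : ℤ → ℝ} (h : ∀ z, ψ z ≤ χ z) : walkAvg n ψ ≤ walkAvg n χ := by
  induction n generalizing ψ χ with
  | zero => exact h 0
  | succ n ih =>
    simp only [walkAvg]
    have h1 := ih (fun z => h (z + 1))
    have h2 := ih (fun z => h (z - 1))
    linarith

theorem walkAvg_eq_zero {n : ℕ} {ψ : ℤ → ℝ} (h : ∀ z : ℤ, |z| ≤ (n : ℤ) → ψ z = 0) : walkAvg n ψ = 0 := by
  induction n generalizing ψ with
  | zero => exact h 0 (by simp)
  | succ n ih =>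
    simp only [walkAvg]
    rw [ih, ih]
    · simp
    · intro z hz; apply h; push_cast; rw [abs_le] at hz ⊢; omega
    · intro z hz; apply h; push_cast; rw [abs_le] at hz ⊢; omega

theorem walkAvg_point (n j : ℕ) :
    walkAvg n (fun z => ind (z = n - 2 * j)) = (n.choose j : ℝ) / 2 ^ n := by
  induction n generalizing j with
  | zero =>
    rcases j with _ | j
    · simp [walkAvg, ind]
    · simp only [walkAvg, Nat.choose_zero_succ]
      rw [ind_of_not (by push_cast; omega)]; simp
  | succ n ih =>
    simp only [walkAvg]
    have h1 : (fun z : ℤ => ind (z + 1 = ((n + 1 : ℕ) : ℤ) - 2 * j))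
        = fun z : ℤ => ind (z = n - 2 * j) := by
      funext z; apply ind_congr; push_cast; omega
    rw [h1, ih]
    rcases j with _ | j
    · rw [walkAvg_eq_zero]
      · simp only [Nat.choose_zero_right, pow_succ]; ring
      · intro z hz; apply ind_of_not; rw [abs_le] at hz; push_cast; omega
    · have h2 : (fun z : ℤ => ind (z - 1 = ((n + 1 : ℕ) : ℤ) - 2 * ((j + 1 : ℕ) : ℤ)))
          = fun z : ℤ => ind (z = n - 2 * j) := by
        funext z; apply ind_congr; push_cast; omega
      rw [h2, ih, Nat.choose_succ_succ]
      push_cast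
      rw [pow_succ]
      field_simp
      ring

/-- The squared form passes through induction: with the recursion for central binomials the step is
4(m+1)²(4m+1) ≤ (4m+5)(2m+1)², whose sides differ by 1. -/
theorem four_pow_le_sqrt_mul_centralBinom (m : ℕ) :
    (4 : ℝ) ^ m ≤ √(4 * m + 1) * (m.centralBinom : ℝ) := by
  have key : ((4 : ℝ) ^ m) ^ 2 ≤ (4 * m + 1) * (m.centralBinom : ℝ) ^ 2 := by
    induction m with
    | zero => simp
    | succ m ih =>
      have h := Nat.succ_mul_centralBinom_succ m
      have h' : ((m : ℝ) + 1) * ((m + 1).centralBinom : ℝ)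
          = 2 * (2 * m + 1) * (m.centralBinom : ℝ) := by exact_mod_cast h
      set C := (m.centralBinom : ℝ)
      set C' := ((m + 1).centralBinom : ℝ)
      have hm : (0 : ℝ) ≤ m := Nat.cast_nonneg m
      have hpos : (0 : ℝ) < ((m : ℝ) + 1) ^ 2 := by positivity
      refine le_of_mul_le_mul_left ?_ hpos
      have e1 : ((m : ℝ) + 1) ^ 2 * ((4 * ((m + 1 : ℕ) : ℝ) + 1) * C' ^ 2)
          = (4 * m + 5) * (2 * (2 * m + 1) * C) ^ 2 := by
        rw [← h']; push_cast; ring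
      rw [e1]
      calc ((m : ℝ) + 1) ^ 2 * ((4 : ℝ) ^ (m + 1)) ^ 2
          = 16 * ((m : ℝ) + 1) ^ 2 * ((4 : ℝ) ^ m) ^ 2 := by ring
        _ ≤ 16 * ((m : ℝ) + 1) ^ 2 * ((4 * m + 1) * C ^ 2) := by gcongr
        _ ≤ (4 * m + 5) * (2 * (2 * m + 1) * C) ^ 2 := by
          have hC : 0 ≤ C ^ 2 := sq_nonneg C
          nlinarith
  rw [← Real.sqrt_sq (show (0 : ℝ) ≤ m.centralBinom from Nat.cast_nonneg _), ← Real.sqrt_mul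
    (by positivity)]
  exact Real.le_sqrt_of_sq_le key

/-- The window has radius 1 so that it serves both parities: an odd walk that is at 0 before its
last step ends inside it. -/
theorem walkAvg_abs_le_one_ge (n : ℕ) :
    1 / (2 * √((n : ℝ) + 1)) ≤ walkAvg n (fun z => ind (|z| ≤ 1)) := by
  have even_case (m : ℕ) : 1 / √(4 * m + 1) ≤ walkAvg (2 * m) (fun z => ind (z = 0)) := by
    have h := walkAvg_point (2 * m) m
    have e : (fun z : ℤ => ind (z = ((2 * m : ℕ) : ℤ) - 2 * m)) = fun z : ℤ => ind (z = 0) := by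
      funext z; apply ind_congr; push_cast; omega
    rw [e] at h
    rw [h, div_le_div_iff₀ (by positivity) (by positivity), one_mul, pow_mul, mul_comm]
    have := four_pow_le_sqrt_mul_centralBinom m
    rw [Nat.centralBinom] at this
    norm_num
    exact this
  have bound (m : ℕ) (hm : 2 * m ≤ n) : 1 / (2 * √((n : ℝ) + 1)) ≤ 1 / √(4 * m + 1) := by
    have hm' : 2 * (m : ℝ) ≤ n := by exact_mod_cast hm
    have h0 : (0 : ℝ) ≤ m := Nat.cast_nonneg m
    apply one_div_le_one_div_of_le (by positivity)
    rw [Real.sqrt_le_left (by positivity), mul_pow, Real.sq_sqrt (by positivity)]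
    linarith
  rcases Nat.even_or_odd' n with ⟨m, rfl | rfl⟩
  · refine (bound m le_rfl).trans ((even_case m).trans (walkAvg_mono fun z => ind_mono ?_))
    rintro rfl; simp
  · refine (bound m (by omega)).trans ((even_case m).trans ?_)
    simp only [walkAvg]
    have h1 : walkAvg (2 * m) (fun z => ind (z = 0)) ≤ walkAvg (2 * m) fun z => ind (|z + 1| ≤ 1) :=
      walkAvg_mono fun z => ind_mono (by rintro rfl; simp)
    have h2 : walkAvg (2 * m) (fun z => ind (z = 0)) ≤ walkAvg (2 * m) fun z => ind (|z - 1| ≤ 1) :=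
      walkAvg_mono fun z => ind_mono (by rintro rfl; simp)
    linarith

/-- This is conditioning: `Φ` ignores the labels in `s` apart from their sum, and that sum is
distributed as a simple walk whatever the signs `c`. -/
theorem expect_signSum {s : Finset ι} {c : ι → ℤ} (hc : ∀ i ∈ s, c i = 1 ∨ c i = -1)
    (Φ : ℤ → (ι → Bool) → ℝ)
    (hΦ : ∀ z x, ∀ i ∈ s, ∀ b, Φ z (Function.update x i b) = Φ z x) :
    𝔼 x, Φ (signSum s c x) x = walkAvg s.card (fun z => 𝔼 x, Φ z x) := by
  induction s using Finset.induction_on generalizing Φ with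
  | empty => simp [signSum, walkAvg]
  | insert i s hi ih =>
    have hc' : ∀ j ∈ s, c j = 1 ∨ c j = -1 := fun j hj => hc j (mem_insert_of_mem hj)
    have step (d : ℤ) := ih hc' (fun z => Φ (z + d)) (fun z x j hj b =>
      hΦ _ x j (mem_insert_of_mem hj) b)
    have hsum (x : ι → Bool) (b : Bool) :
        signSum (insert i s) c (Function.update x i b) = signSum s c x + c i * boolSign b := by
      rw [signSum, Finset.sum_insert hi, ← signSum, signSum_update hi, Function.update_self,
        add_comm]
    rw [expect_eq_expect_update i, card_insert_of_notMem hi]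
    simp only [hsum, hΦ _ _ i (mem_insert_self i s), walkAvg]
    rw [← Finset.expect_div, Finset.expect_add_distrib, step, step]
    rcases hc i (mem_insert_self i s) with h | h
    · simp [h, sub_eq_add_neg]
    · simp [h, sub_eq_add_neg, add_comm]

/-- Monotone functions of two signed sums with opposite coefficients are negatively correlated
(Harris' inequality). -/
theorem expect_mul_le_of_opposite {s : Finset ι} {a b : ι → ℤ} (hab : ∀ i ∈ s, a i * b i ≤ 0)
    {f g : ℤ → ℝ} (hf : Monotone f) (hg : Monotone g) (hf0 : ∀ z, 0 ≤ f z) (hg1 : ∀ z, g z ≤ 1) :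
    𝔼 x, f (signSum s a x) * g (signSum s b x)
      ≤ (𝔼 x, f (signSum s a x)) * 𝔼 x, g (signSum s b x) := by
  classical
  -- Complementing these coordinates makes the `a`-sum nondecreasing and the `b`-sum nonincreasing
  -- in every label, so the FKG inequality applies to `f` and `1 - g`. Where `a i = 0` the sign of
  -- `b i` decides.
  let p : ι → Bool := fun i => decide (a i < 0 ∨ (a i = 0 ∧ 0 < b i))
  have hpa : ∀ i ∈ s, ∀ u v : Bool, u ≤ v →
      a i * boolSign (xor (p i) u) ≤ a i * boolSign (xor (p i) v) := by
    intro i hi u v huv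
    have h1 := boolSign_mono huv
    by_cases h : a i < 0 ∨ (a i = 0 ∧ 0 < b i)
    · have hp : p i = true := by simp [p, h]
      simp only [hp, Bool.true_xor, boolSign_not]
      rcases h with h | h
      · nlinarith
      · simp [h.1]
    · have hp : p i = false := by simp only [p, h, decide_false]
      simp only [hp, Bool.false_xor]
      push Not at h
      exact mul_le_mul_of_nonneg_left h1 h.1
  have hpb : ∀ i ∈ s, ∀ u v : Bool, u ≤ v →
      b i * boolSign (xor (p i) v) ≤ b i * boolSign (xor (p i) u) := by
    intro i hi u v huv
    have h1 := boolSign_mono huv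
    have h2 := hab i hi
    by_cases h : a i < 0 ∨ (a i = 0 ∧ 0 < b i)
    · have hp : p i = true := by simp [p, h]
      simp only [hp, Bool.true_xor, boolSign_not]
      have : 0 ≤ b i := by
        rcases h with h | h
        · by_contra hb; push Not at hb; nlinarith [mul_pos_of_neg_of_neg h hb]
        · exact h.2.le
      nlinarith
    · have hp : p i = false := by simp only [p, h, decide_false]
      simp only [hp, Bool.false_xor]
      push Not at h
      have : b i ≤ 0 := by
        rcases h.1.lt_or_eq with h' | h'
        · by_contra hb; push Not at hb; nlinarith [mul_pos h' hb]
        · exact h.2 h'.symm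
      nlinarith
  have tr (F : (ι → Bool) → ℝ) : 𝔼 x, F x = 𝔼 x, F (cubeFlip p x) :=
    (Fintype.expect_equiv (cubeFlip p) _ _ fun x => rfl).symm
  have key := fkg (α := ι → Bool) (μ := fun _ => (1 : ℝ))
    (f := fun x => f (signSum s a (cubeFlip p x)))
    (g := fun x => 1 - g (signSum s b (cubeFlip p x))) (fun _ => zero_le_one)
    (fun x => hf0 _) (fun x => sub_nonneg.2 (hg1 _))
    (fun x y hxy => hf (Finset.sum_le_sum fun i hi => hpa i hi _ _ (hxy i)))
    (fun x y hxy => sub_le_sub_left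
      (hg (Finset.sum_le_sum fun i hi => hpb i hi _ _ (hxy i))) 1)
    (fun _ _ => le_rfl)
  rw [tr, tr (fun x => f (signSum s a x)), tr (fun x => g (signSum s b x))]
  simp only [Finset.expect_eq_sum_div_card]
  simp only [one_mul, mul_sub, mul_one, Finset.sum_sub_distrib, Finset.sum_const, nsmul_eq_mul]
    at key
  have hN : (0 : ℝ) < ((univ : Finset (ι → Bool)).card : ℝ) := by
    exact_mod_cast Finset.card_pos.2 univ_nonempty
  set N := ((univ : Finset (ι → Bool)).card : ℝ)
  rw [div_mul_div_comm, div_le_div_iff₀ hN (mul_pos hN hN)]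
  nlinarith

end Cube

end MaxBisection

/-! ### The probabilistic inequality for two signed sums. -/

namespace MaxBisection

open Finset
open scoped BigOperators

/-- The properties used of the distribution function of a symmetric integer random variable. -/
structure IsSymmetricCdf (F : ℤ → ℝ) : Prop where
  mono : Monotone F
  le_one : ∀ z, F z ≤ 1
  reflect : ∀ z, F (-1 - z) = 1 - F z

namespace IsSymmetricCdf

variable {F G : ℤ → ℝ}

theorem half_le (hF : IsSymmetricCdf F) {z : ℤ} (hz : 0 ≤ z) : 1 / 2 ≤ F z := by
  have h1 := hF.reflect z
  have h2 := hF.mono (show -1 - z ≤ z by omega)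
  linarith

theorem reflect' (hF : IsSymmetricCdf F) {w z : ℤ} (h : w = -1 - z) : F w = 1 - F z := by
  rw [h, hF.reflect]

/-- The excess of `1/2` of two symmetric distribution functions, one at `z`, one at `w`, has
a product bounded by a quarter of its sum. -/
theorem excess_mul_le (hF : IsSymmetricCdf F) (hG : IsSymmetricCdf G) {z w : ℤ} (hz : 0 ≤ z)
    (hw : 0 ≤ w) :
    (F z - 1 / 2) * (G w - 1 / 2) ≤ (F z - 1 / 2 + (G w - 1 / 2)) / 4 := by
  have h1 := hF.half_le hz
  have h2 := hG.half_le hw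
  have h3 := hF.le_one z
  have h4 := hG.le_one w
  nlinarith [mul_nonneg (sub_nonneg.2 h1) (sub_nonneg.2 h4),
    mul_nonneg (sub_nonneg.2 h2) (sub_nonneg.2 h3)]

theorem excess_mul_le' (hF : IsSymmetricCdf F) (hG : IsSymmetricCdf G) {z : ℤ} (w : ℤ)
    (hz : 0 ≤ z) : (F z - 1 / 2) * (G w - 1 / 2) ≤ (F z - 1 / 2) / 2 := by
  have h1 := hF.half_le hz
  have h4 := hG.le_one w
  nlinarith [mul_nonneg (sub_nonneg.2 h1) (sub_nonneg.2 h4)]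

/-- The walk positions `z` and `-z` are taken together. Written in excesses over 1/2, the products
become linear by `excess_mul_le` and `excess_mul_le'`, which separates `F` from `G`. For `z ≥ 2` the
coefficients on each side sum to -1, a loss that the positions 0 and ±1 have to pay for. -/
theorem cut_excess_two_le (hF : IsSymmetricCdf F) (hG : IsSymmetricCdf G) {z : ℤ} (hz : 2 ≤ z) :
    (F (z + 1) - 1 / 2) / 2 + (F z - 1 / 2) / 4 - (F (z - 2) - 1 / 2) - 3 / 4 * (F (z - 1) - 1 / 2)
      + ((G (z + 1) - 1 / 2) / 2 + (G z - 1 / 2) / 4 - (G (z - 2) - 1 / 2)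
        - 3 / 4 * (G (z - 1) - 1 / 2))
      ≤ F (1 - z) * G (1 + z) + F (1 + z) * G (1 - z) - F (-1 - z) * G (-1 - z)
        - F (-1 + z) * G (-1 + z) := by
  rw [hF.reflect, hG.reflect, hF.reflect' (show 1 - z = -1 - (z - 2) by ring),
    hG.reflect' (show 1 - z = -1 - (z - 2) by ring), add_comm 1 z, add_comm (-1) z,
    ← sub_eq_add_neg]
  have h1 := excess_mul_le hF hG (show 0 ≤ z by omega) (show 0 ≤ z by omega)
  have h2 := excess_mul_le hF hG (show 0 ≤ z - 1 by omega) (show 0 ≤ z - 1 by omega)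
  have h3 := excess_mul_le' hF hG (z + 1) (show 0 ≤ z - 2 by omega)
  have h4 := excess_mul_le' hG hF (z + 1) (show 0 ≤ z - 2 by omega)
  linarith

theorem cut_excess_one_le (hF : IsSymmetricCdf F) (hG : IsSymmetricCdf G) :
    (F 2 - 1 / 2) / 2 + (F 1 - 1 / 2) / 4 + ((G 2 - 1 / 2) / 2 + (G 1 - 1 / 2) / 4)
      ≤ F 0 * G 2 + F 2 * G 0 - F (-2) * G (-2) - F 0 * G 0 := by
  rw [hF.reflect' (show (-2 : ℤ) = -1 - 1 by norm_num),
    hG.reflect' (show (-2 : ℤ) = -1 - 1 by norm_num)]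
  have h1 := excess_mul_le hF hG (show (0 : ℤ) ≤ 1 by norm_num) (show (0 : ℤ) ≤ 1 by norm_num)
  have h2 := mul_nonneg (sub_nonneg.2 (hF.half_le le_rfl))
    (sub_nonneg.2 (hG.mono (show (0 : ℤ) ≤ 2 by norm_num)))
  have h3 := mul_nonneg (sub_nonneg.2 (hG.half_le (show (0 : ℤ) ≤ 0 from le_rfl)))
    (sub_nonneg.2 (hF.half_le (show (0 : ℤ) ≤ 2 by norm_num)))
  linarith

theorem cut_excess_zero_le (hF : IsSymmetricCdf F) (hG : IsSymmetricCdf G) :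
    (F 1 - 1 / 2) + (F 0 - 1 / 2) + ((G 1 - 1 / 2) + (G 0 - 1 / 2))
      ≤ 2 * (F 1 * G 1 - F (-1) * G (-1)) := by
  rw [hF.reflect' (show (-1 : ℤ) = -1 - 0 by norm_num),
    hG.reflect' (show (-1 : ℤ) = -1 - 0 by norm_num)]
  have h1 := hF.mono (show (0 : ℤ) ≤ 1 by norm_num)
  have h2 := hG.mono (show (0 : ℤ) ≤ 1 by norm_num)
  have h3 := hF.half_le (show (0 : ℤ) ≤ 0 from le_rfl)
  have h4 := hG.half_le (show (0 : ℤ) ≤ 0 from le_rfl)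
  nlinarith [mul_nonneg (sub_nonneg.2 h3) (sub_nonneg.2 h2),
    mul_nonneg (sub_nonneg.2 (h4.trans h2)) (sub_nonneg.2 h1)]

theorem walkAvg_cut_excess_ge (hF : IsSymmetricCdf F) (hG : IsSymmetricCdf G) {t : ℕ}
    (ht : t ≤ 5) :
    (F 1 - 1 / 2 + (G 1 - 1 / 2)) / 64
      ≤ walkAvg t (fun z => F (1 - z) * G (1 + z) - F (-1 - z) * G (-1 - z)) := by
  have T0 := cut_excess_zero_le hF hG
  have T1 := cut_excess_one_le hF hG
  have T2 := cut_excess_two_le hF hG (le_refl (2 : ℤ))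
  have T3 := cut_excess_two_le hF hG (show (2 : ℤ) ≤ 3 by norm_num)
  have T4 := cut_excess_two_le hF hG (show (2 : ℤ) ≤ 4 by norm_num)
  have T5 := cut_excess_two_le hF hG (show (2 : ℤ) ≤ 5 by norm_num)
  have f0 := hF.half_le (le_refl (0 : ℤ))
  have g0 := hG.half_le (le_refl (0 : ℤ))
  have f1 := hF.mono (show (0 : ℤ) ≤ 1 by norm_num)
  have f2 := hF.mono (show (1 : ℤ) ≤ 2 by norm_num)
  have f3 := hF.mono (show (2 : ℤ) ≤ 3 by norm_num)
  have f4 := hF.mono (show (3 : ℤ) ≤ 4 by norm_num)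
  have f5 := hF.mono (show (4 : ℤ) ≤ 5 by norm_num)
  have f6 := hF.mono (show (5 : ℤ) ≤ 6 by norm_num)
  have g1 := hG.mono (show (0 : ℤ) ≤ 1 by norm_num)
  have g2 := hG.mono (show (1 : ℤ) ≤ 2 by norm_num)
  have g3 := hG.mono (show (2 : ℤ) ≤ 3 by norm_num)
  have g4 := hG.mono (show (3 : ℤ) ≤ 4 by norm_num)
  have g5 := hG.mono (show (4 : ℤ) ≤ 5 by norm_num)
  have g6 := hG.mono (show (5 : ℤ) ≤ 6 by norm_num)
  norm_num at T0 T1 T2 T3 T4 T5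
  -- With binomial weights the negative coefficients fall on smaller arguments, so monotonicity
  -- reduces the claim to the coefficient sums. For `t = 5` the sum is 10·(3/4) - 5 - 1 = 3/2, over
  -- 32; for `t = 6` it would be 20 - 15 - 6 - 1 < 0.
  interval_cases t <;> simp only [walkAvg] <;> norm_num <;> linarith

end IsSymmetricCdf

variable {ι : Type*} [Fintype ι] [DecidableEq ι]

theorem signSum_filter_ne_zero {ι : Type*} (s : Finset ι) (a : ι → ℤ) (x : ι → Bool) :
    signSum (s.filter fun i => a i ≠ 0) a x = signSum s a x := by
  refine Finset.sum_filter_of_ne fun i _ h h0 => h (by rw [h0, zero_mul])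

/-- The distribution function of a signed sum of uniform random labels. -/
noncomputable def signCdf (s : Finset ι) (a : ι → ℤ) (z : ℤ) : ℝ :=
  𝔼 x : ι → Bool, ind (signSum s a x ≤ z)

theorem expect_ind_ge_eq_signCdf (s : Finset ι) (a : ι → ℤ) {w z : ℤ} (h : w = -z) :
    𝔼 x : ι → Bool, ind (w ≤ signSum s a x) = signCdf s a z := by
  rw [signCdf, ← expect_compl]
  refine Finset.expect_congr rfl fun x _ => ind_congr ?_
  rw [signSum_compl]; omega

theorem isSymmetricCdf_signCdf (s : Finset ι) (a : ι → ℤ) : IsSymmetricCdf (signCdf s a) where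
  mono z w h := Finset.expect_le_expect fun x _ => ind_mono fun h' => h'.trans h
  le_one z := Finset.expect_le univ_nonempty fun x _ => ind_le_one _
  reflect z := by
    rw [← expect_ind_ge_eq_signCdf s a (show z + 1 = -(-1 - z) by ring), signCdf,
      eq_sub_iff_add_eq, ← Finset.expect_add_distrib]
    rw [← Fintype.expect_const (ι := ι → Bool) (1 : ℝ)]
    refine Finset.expect_congr rfl fun x _ => ?_
    rw [ind_congr (show z + 1 ≤ signSum s a x ↔ ¬signSum s a x ≤ z by omega), ind_not]
    ring

/-- By symmetry twice the excess at 1 is the probability that the sum lies in [-1, 1], to which the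
walk estimate applies. -/
theorem signCdf_one_ge {s : Finset ι} {a : ι → ℤ} (ha : ∀ i ∈ s, a i ≠ 0 → a i = 1 ∨ a i = -1)
    {d : ℕ} (hd : (s.filter fun i => a i ≠ 0).card + 1 ≤ d) :
    1 / √(d : ℝ) / 4 ≤ signCdf s a 1 - 1 / 2 := by
  have hc := isSymmetricCdf_signCdf s a
  have h2 : signCdf s a (-2) = 1 - signCdf s a 1 := hc.reflect' (by norm_num)
  have e : signCdf s a 1 - signCdf s a (-2)
      = walkAvg (s.filter fun i => a i ≠ 0).card (fun z => ind (|z| ≤ 1)) := by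
    have h := expect_signSum (s := s.filter fun i => a i ≠ 0) (c := a)
      (fun i hi => ha i (mem_filter.1 hi).1 (mem_filter.1 hi).2)
      (fun z _ => ind (|z| ≤ 1)) (fun _ _ _ _ _ => rfl)
    simp only [Fintype.expect_const, signSum_filter_ne_zero] at h
    rw [← h, signCdf, signCdf, ← Finset.expect_sub_distrib]
    refine Finset.expect_congr rfl fun x _ => ?_
    rw [ind_congr (show |signSum s a x| ≤ 1 ↔ signSum s a x ≤ 1 ∧ ¬signSum s a x ≤ -2 by
      rw [abs_le]; omega), ind_and, ind_not]
    by_cases h1 : signSum s a x ≤ -2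
    · rw [ind_of h1, ind_of (by omega)]; ring
    · rw [ind_of_not h1]; ring
  have hk := walkAvg_abs_le_one_ge (s.filter fun i => a i ≠ 0).card
  have hd' : ((s.filter fun i => a i ≠ 0).card : ℝ) + 1 ≤ d := by exact_mod_cast hd
  have hle : 1 / √(d : ℝ) ≤ 1 / √(((s.filter fun i => a i ≠ 0).card : ℝ) + 1) :=
    one_div_le_one_div_of_le (by positivity) (Real.sqrt_le_sqrt hd')
  have e2 : 1 / (2 * √(((s.filter fun i => a i ≠ 0).card : ℝ) + 1))
      = 1 / √(((s.filter fun i => a i ≠ 0).card : ℝ) + 1) / 2 := by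
    field_simp
  linarith

theorem cut_excess_ge_of_opposite {s : Finset ι} {a b : ι → ℤ} (hab : ∀ i ∈ s, a i * b i ≤ 0)
    (z : ℤ) :
    signCdf s a (1 - z) * signCdf s b (1 + z) - signCdf s a (-1 - z) * signCdf s b (-1 - z)
      ≤ 𝔼 x : ι → Bool, (ind (z + signSum s a x ≤ 1 ∧ -1 ≤ z + signSum s b x)
          - ind (z + signSum s a x ≤ -1 ∧ z + signSum s b x ≤ -1)) := by
  have upper (α : ℤ) : Monotone fun w : ℤ => ind (α < w) := fun v w h =>
    ind_mono fun h' => h'.trans_le h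
  have eU (c : ι → ℤ) (α : ℤ) : 𝔼 x : ι → Bool, ind (α < signSum s c x) = 1 - signCdf s c α := by
    rw [← (isSymmetricCdf_signCdf s c).reflect,
      ← expect_ind_ge_eq_signCdf s c (show α + 1 = -(-1 - α) by ring)]
    rfl
  -- Both events are expressed through upper tails. This use of Harris bounds the first probability
  -- from below, the next one bounds the second from above.
  have h1 := expect_mul_le_of_opposite hab (upper (1 - z)) (upper (-2 - z))
    (fun _ => ind_nonneg _) (fun _ => ind_le_one _)
  have h2 := expect_mul_le_of_opposite hab (upper (-1 - z)) (upper (-1 - z))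
    (fun _ => ind_nonneg _) (fun _ => ind_le_one _)
  simp only [eU] at h1 h2
  have eL (c : ι → ℤ) (α : ℤ) (x : ι → Bool) :
      ind (α < signSum s c x) = 1 - ind (signSum s c x ≤ α) := by
    rw [← ind_not]; exact ind_congr not_le.symm
  have e1 (x : ι → Bool) : ind (z + signSum s a x ≤ 1 ∧ -1 ≤ z + signSum s b x)
      = ind (-2 - z < signSum s b x)
        - ind (1 - z < signSum s a x) * ind (-2 - z < signSum s b x) := by
    rw [ind_and, ind_congr (show z + signSum s a x ≤ 1 ↔ ¬1 - z < signSum s a x by omega), ind_not,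
      ind_congr (show -1 ≤ z + signSum s b x ↔ -2 - z < signSum s b x by omega)]
    ring
  have e2 (x : ι → Bool) : ind (z + signSum s a x ≤ -1 ∧ z + signSum s b x ≤ -1)
      = 1 - ind (-1 - z < signSum s a x) - ind (-1 - z < signSum s b x)
        + ind (-1 - z < signSum s a x) * ind (-1 - z < signSum s b x) := by
    rw [ind_and, ind_congr (show z + signSum s a x ≤ -1 ↔ ¬-1 - z < signSum s a x by omega),
      ind_congr (show z + signSum s b x ≤ -1 ↔ ¬-1 - z < signSum s b x by omega), ind_not, ind_not]
    ring
  have r : signCdf s b (-2 - z) = 1 - signCdf s b (1 + z) :=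
    (isSymmetricCdf_signCdf s b).reflect' (by ring)
  simp only [e1, e2, Finset.expect_sub_distrib, Finset.expect_add_distrib, eU,
    Fintype.expect_const]
  rw [r] at h1 ⊢
  linarith

/-- If at most five coordinates have coefficients `±1` of the same sign in two sums `A` and `B` of
random signs, then `(A ≤ 1, B ≥ -1)` is more probable than `(A ≤ -1, B ≤ -1)`, by the stated
amount. -/
theorem cut_excess_ge {a b : ι → ℤ} (ha : ∀ i, a i = 0 ∨ a i = 1 ∨ a i = -1)
    (hb : ∀ i, b i = 0 ∨ b i = 1 ∨ b i = -1)
    (hab : (univ.filter fun i => a i * b i = 1).card ≤ 5) {d e : ℕ}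
    (hd : (univ.filter fun i => a i ≠ 0).card + 1 ≤ d)
    (he : (univ.filter fun i => b i ≠ 0).card + 1 ≤ e) :
    (1 / √(d : ℝ) + 1 / √(e : ℝ)) / 256
      ≤ 𝔼 x : ι → Bool, (ind (signSum univ a x ≤ 1 ∧ -1 ≤ signSum univ b x)
          - ind (signSum univ a x ≤ -1 ∧ signSum univ b x ≤ -1)) := by
  set T := univ.filter fun i => a i * b i = 1 with hT
  have hab' : ∀ i ∈ T, a i = b i := by
    intro i hi
    have h := (mem_filter.1 hi).2
    rcases ha i with h1 | h1 | h1 <;> rcases hb i with h2 | h2 | h2 <;> simp_all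
  have hT1 : ∀ i ∈ T, a i = 1 ∨ a i = -1 := by
    intro i hi
    have h := (mem_filter.1 hi).2
    rcases ha i with h1 | h1
    · simp [h1] at h
    · exact h1
  have hopp : ∀ i ∈ Tᶜ, a i * b i ≤ 0 := by
    intro i hi
    have h : ¬a i * b i = 1 := by simpa [hT] using hi
    rcases ha i with h1 | h1 | h1 <;> rcases hb i with h2 | h2 | h2 <;> simp_all
  have split (c : ι → ℤ) (x : ι → Bool) : signSum univ c x = signSum T c x + signSum Tᶜ c x :=
    (Finset.sum_add_sum_compl T _).symm
  have eT (x : ι → Bool) : signSum T b x = signSum T a x :=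
    Finset.sum_congr rfl fun i hi => by rw [hab' i hi]
  simp only [split, eT]
  -- Condition on the common sum over `T`; on the complement of `T` the coefficients are opposite.
  have h := expect_signSum hT1
    (fun z x => ind (z + signSum Tᶜ a x ≤ 1 ∧ -1 ≤ z + signSum Tᶜ b x)
      - ind (z + signSum Tᶜ a x ≤ -1 ∧ z + signSum Tᶜ b x ≤ -1))
    (fun z x i hi β => by
      have hi' : i ∉ Tᶜ := by simpa using hi
      simp only [signSum_update hi'])
  rw [h]
  refine le_trans ?_ (walkAvg_mono (cut_excess_ge_of_opposite hopp))
  refine le_trans ?_ (IsSymmetricCdf.walkAvg_cut_excess_ge (isSymmetricCdf_signCdf _ _)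
    (isSymmetricCdf_signCdf _ _) hab)
  have h1 := signCdf_one_ge (s := Tᶜ) (a := a) (fun i _ h0 => (ha i).resolve_left h0)
    (d := d) (le_trans (by gcongr; exact subset_univ _) hd)
  have h2 := signCdf_one_ge (s := Tᶜ) (a := b) (fun i _ h0 => (hb i).resolve_left h0)
    (d := e) (le_trans (by gcongr; exact subset_univ _) he)
  linarith

end MaxBisection

/-! ### Maximum matchings and the choice of the quasi-perfect matching. -/

namespace MaxBisection

open Finset

section Matching

variable {V : Type*} {G : SimpleGraph V}

theorem isMatching_sup_subgraphOfAdj {N : G.Subgraph} (hN : N.IsMatching) {r s : V}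
    (hr : r ∉ N.verts) (hs : s ∉ N.verts) (h : G.Adj r s) :
    (N ⊔ G.subgraphOfAdj h).IsMatching := by
  refine hN.sup (SimpleGraph.Subgraph.IsMatching.subgraphOfAdj h) ?_
  rw [hN.support_eq_verts, SimpleGraph.support_subgraphOfAdj, Set.disjoint_right]
  rintro v (rfl | rfl) <;> assumption

theorem ncard_edgeSet_sup_subgraphOfAdj [Finite V] {N : G.Subgraph} {r s : V}
    (hr : r ∉ N.verts) (h : G.Adj r s) :
    (N ⊔ G.subgraphOfAdj h).edgeSet.ncard = N.edgeSet.ncard + 1 := by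
  rw [SimpleGraph.Subgraph.edgeSet_sup, SimpleGraph.edgeSet_subgraphOfAdj, Set.union_singleton]
  refine Set.ncard_insert_of_notMem (fun hmem => hr ?_) (Set.toFinite _)
  exact (SimpleGraph.Subgraph.mem_edgeSet.1 hmem).fst_mem

namespace IsMaximumMatching

variable [Finite V] {M : G.Subgraph}

theorem not_adj (hM : IsMaximumMatching G M) {r s : V} (hr : r ∉ M.verts) (hs : s ∉ M.verts) :
    ¬G.Adj r s := fun h => by
  have h1 := hM.2 _ (isMatching_sup_subgraphOfAdj hM.1 hr hs h)
  rw [ncard_edgeSet_sup_subgraphOfAdj hr h] at h1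
  omega

/-- A maximum matching has no augmenting path with three edges. -/
theorem not_augmenting (hM : IsMaximumMatching G M) {r a b s : V} (hr : r ∉ M.verts)
    (hs : s ∉ M.verts) (hrs : r ≠ s) (hab : M.Adj a b) (hra : G.Adj r a) (hbs : G.Adj b s) :
    False := by
  have hne : a ≠ b := hab.ne
  -- Replacing the edge `ab` by `ra` and `bs` would give a matching with one more edge.
  have hN : (M.deleteVerts {a, b}).IsMatching := by
    intro v hv
    rw [SimpleGraph.Subgraph.deleteVerts_verts] at hv
    obtain ⟨w, hw, hw'⟩ := hM.1 hv.1
    have h1 : w ≠ a := by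
      rintro rfl
      exact hv.2 (Or.inr (hM.1.eq_of_adj_left hw.symm hab))
    have h2 : w ≠ b := by
      rintro rfl
      exact hv.2 (Or.inl (hM.1.eq_of_adj_right hw hab))
    refine ⟨w, ?_, fun y hy => hw' y (SimpleGraph.Subgraph.deleteVerts_le.2 hy)⟩
    refine SimpleGraph.Subgraph.deleteVerts_adj.2 ?_
    exact ⟨hv.1, hv.2, hw.snd_mem, by simp [h1, h2], hw⟩
  have hrN : r ∉ (M.deleteVerts {a, b}).verts := fun h => hr h.1
  have haN : a ∉ (M.deleteVerts {a, b}).verts := fun h => h.2 (Or.inl rfl)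
  have hbN : b ∉ (M.deleteVerts {a, b}).verts := fun h => h.2 (Or.inr rfl)
  have hsN : s ∉ (M.deleteVerts {a, b}).verts := fun h => hs h.1
  have hN1 := isMatching_sup_subgraphOfAdj hN hrN haN hra
  have hb1 : b ∉ (M.deleteVerts {a, b} ⊔ G.subgraphOfAdj hra).verts := by
    rintro (h | h | h)
    · exact hbN h
    · exact hr (h ▸ hab.snd_mem)
    · exact hne h.symm
  have hs1 : s ∉ (M.deleteVerts {a, b} ⊔ G.subgraphOfAdj hra).verts := by
    rintro (h | h | h)
    · exact hsN h
    · exact hrs h.symm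
    · exact hs (h ▸ hab.fst_mem)
  have h1 := hM.2 _ (isMatching_sup_subgraphOfAdj hN1 hb1 hs1 hbs)
  rw [ncard_edgeSet_sup_subgraphOfAdj hb1 hbs, ncard_edgeSet_sup_subgraphOfAdj hrN hra] at h1
  have hsub : M.edgeSet ⊆ insert s(a, b) (M.deleteVerts {a, b}).edgeSet := by
    intro e
    induction e with
    | _ v w =>
      intro he
      rw [SimpleGraph.Subgraph.mem_edgeSet] at he
      by_cases hv : v = a
      · subst hv
        exact Or.inl (by rw [hM.1.eq_of_adj_left he hab])
      by_cases hv' : v = b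
      · subst hv'
        exact Or.inl (by rw [hM.1.eq_of_adj_left he hab.symm, Sym2.eq_swap])
      by_cases hw : w = a
      · subst hw
        exact absurd (hM.1.eq_of_adj_left he.symm hab) hv'
      by_cases hw' : w = b
      · subst hw'
        exact absurd (hM.1.eq_of_adj_right he hab) hv
      right
      rw [SimpleGraph.Subgraph.mem_edgeSet, SimpleGraph.Subgraph.deleteVerts_adj]
      exact ⟨he.fst_mem, by simp [hv, hv'], he.snd_mem, by simp [hw, hw'], he⟩
  have h2 := Set.ncard_le_ncard hsub (Set.toFinite _)
  have h3 := Set.ncard_insert_le s(a, b) (M.deleteVerts {a, b}).edgeSet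
  omega

end IsMaximumMatching

theorem exists_isMaximumMatching [Finite V] (G : SimpleGraph V) :
    ∃ M : G.Subgraph, IsMaximumMatching G M := by
  obtain ⟨M, h1, h2⟩ := Set.exists_max_image {M : G.Subgraph | M.IsMatching}
    (fun M => M.edgeSet.ncard) (Set.toFinite _) ⟨⊥, fun _ h => h.elim⟩
  exact ⟨M, h1, fun M' h => h2 M' h⟩

/-- A fixed-point-free involution of the vertices that extends the matching `M`. -/
structure IsPairing (M : G.Subgraph) (m : V → V) : Prop where
  invol : ∀ v, m (m v) = v
  ne : ∀ v, m v ≠ v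
  extend : ∀ v w, M.Adj v w → m v = w

theorem exists_isPairing [Fintype V] {M : G.Subgraph} (hM : M.IsMatching)
    (hV : Even (Fintype.card V)) : ∃ m, IsPairing M m := by
  classical
  have hW : Even (Fintype.card {v // v ∉ M.verts}) := by
    rw [Fintype.card_subtype_compl, Nat.even_sub (Fintype.card_subtype_le _)]
    have h := hM.even_card
    rw [Set.toFinset_card] at h
    exact iff_of_true hV h
  obtain ⟨n, hn⟩ := hW
  let e : {v // v ∉ M.verts} ≃ Fin n × Bool := Fintype.equivOfCardEq (by simp [hn]; ring)
  have hx (v : V) (hv : v ∈ M.verts) : ∃ w, M.Adj v w := (hM hv).exists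
  choose p hp using hx
  let m : V → V := fun v => if h : v ∈ M.verts then p v h else
    (e.symm ((e ⟨v, h⟩).1, !(e ⟨v, h⟩).2)).1
  have m1 (v w : V) (h : M.Adj v w) : m v = w := by
    have hv := h.fst_mem
    simp only [m, hv, dite_true]
    exact hM.eq_of_adj_left (hp v hv) h
  have m2 (x : {v // v ∉ M.verts}) : m x = (e.symm ((e x).1, !(e x).2)).1 := by
    simp only [m, x.2, dite_false]
  refine ⟨m, fun v => ?_, fun v => ?_, m1⟩
  · by_cases h : v ∈ M.verts
    · rw [m1 v _ (hp v h), m1 _ v (hp v h).symm]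
    · rw [m2 ⟨v, h⟩, m2]; simp
  · by_cases h : v ∈ M.verts
    · rw [m1 v _ (hp v h)]; exact (hp v h).ne.symm
    · rw [m2 ⟨v, h⟩]
      intro h'
      have := congrArg e (Subtype.ext h' : e.symm ((e ⟨v, h⟩).1, !(e ⟨v, h⟩).2) = ⟨v, h⟩)
      rw [Equiv.apply_symm_apply] at this
      simpa using congrArg Prod.snd this

/-- The vertices `v` and `w` have a common neighbour. -/
def HasCommonNbr (G : SimpleGraph V) (v w : V) : Prop := ∃ x, G.Adj v x ∧ G.Adj w x

theorem HasCommonNbr.symm {v w : V} (h : HasCommonNbr G v w) : HasCommonNbr G w v :=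
  h.imp fun _ hx => hx.symm

/-- Take a pairing with the most vertices that share a neighbour with their mate. If the conclusion
failed for `r` and `s`, pairing `r` with `s` and their old mates with each other would gain `r` and
lose nothing. -/
theorem exists_isPairing_exchange [Fintype V] {M : G.Subgraph} (hM : M.IsMatching)
    (hV : Even (Fintype.card V)) :
    ∃ m, IsPairing M m ∧ ∀ r s, r ∉ M.verts → s ∉ M.verts → s ≠ r → s ≠ m r →
      HasCommonNbr G r s → HasCommonNbr G r (m r) ∨ HasCommonNbr G s (m s) := by
  classical
  obtain ⟨m, hm, hmax⟩ := Set.exists_max_image {m | IsPairing M m}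
    (fun m => {v | HasCommonNbr G v (m v)}.ncard) (Set.toFinite _) (exists_isPairing hM hV)
  have hm : IsPairing M m := hm
  have mate_notMem {r : V} (hr : r ∉ M.verts) : m r ∉ M.verts := fun h => by
    obtain ⟨w, hw, -⟩ := hM h
    have h1 := hm.extend _ _ hw
    rw [hm.invol] at h1
    exact hr (h1 ▸ hw.snd_mem)
  refine ⟨m, hm, fun r s hr hs hsr hsm hc => ?_⟩
  by_contra! hno
  obtain ⟨hr', hs'⟩ := hno
  -- Conjugation by this transposition performs the exchange; it fixes all matched vertices, so the
  -- new pairing still extends `M`.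
  let τ := Equiv.swap (m r) s
  have fix {v : V} (h1 : v ≠ m r) (h2 : v ≠ s) : τ v = v := Equiv.swap_apply_of_ne_of_ne h1 h2
  have fixM {v : V} (h : v ∈ M.verts) : τ v = v :=
    fix (by rintro rfl; exact mate_notMem hr h) (by rintro rfl; exact hs h)
  have hm' : IsPairing M fun v => τ (m (τ v)) :=
    { invol := fun v => by simp [τ, hm.invol]
      ne := fun v h => hm.ne (τ v) (by
        have := congrArg τ h
        simpa [τ] using this)
      extend := fun v w h => by
        simp only [fixM h.fst_mem, hm.extend v w h, fixM h.snd_mem] }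
  have hlt : {v | HasCommonNbr G v (m v)} ⊂ {v | HasCommonNbr G v (τ (m (τ v)))} := by
    rw [Set.ssubset_iff_of_subset]
    · refine ⟨r, ?_, hr'⟩
      rw [Set.mem_ofPred_eq, fix (hm.ne r).symm hsr.symm, Equiv.swap_apply_left]
      exact hc
    · intro v hv
      rw [Set.mem_ofPred_eq] at hv ⊢
      have h1 : v ≠ m r := by
        rintro rfl; rw [hm.invol] at hv; exact hr' hv.symm
      have h2 : v ≠ s := by rintro rfl; exact hs' hv
      have h3 : m v ≠ m r := fun h => by
        have h' := congrArg m h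
        rw [hm.invol, hm.invol] at h'
        subst h'; exact hr' hv
      have h4 : m v ≠ s := by
        rintro rfl; rw [hm.invol] at hs'; exact hs' hv.symm
      rwa [fix h1 h2, fix h3 h4]
  exact absurd (hmax _ hm') (not_le.2 (Set.ncard_lt_ncard hlt (Set.toFinite _)))

/-- The facts about a suitable quasi-perfect matching that are used below; `W` is the set of the
vertices that are missed by the underlying maximum matching. -/
structure IsExchangeable (M : QuasiPerfectMatching G) (W : Set V) : Prop where
  not_adj : ∀ r ∈ W, ∀ s ∈ W, ¬G.Adj r s
  adj_mate : ∀ v, v ∉ W → G.Adj v (M.mate v)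
  mate_mem : ∀ v ∈ W, M.mate v ∈ W
  not_augmenting : ∀ r ∈ W, ∀ s ∈ W, r ≠ s → ∀ a ∉ W, G.Adj r a → ¬G.Adj (M.mate a) s
  exchange : ∀ r ∈ W, ∀ s ∈ W, s ≠ r → s ≠ M.mate r → HasCommonNbr G r s →
    HasCommonNbr G r (M.mate r) ∨ HasCommonNbr G s (M.mate s)

theorem exists_isExchangeable [Fintype V] (G : SimpleGraph V) (hV : Even (Fintype.card V)) :
    ∃ (M : QuasiPerfectMatching G) (W : Set V), IsExchangeable M W := by
  obtain ⟨M₀, hM₀⟩ := exists_isMaximumMatching G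
  obtain ⟨m, hm, hex⟩ := exists_isPairing_exchange hM₀.1 hV
  have mate_adj {v : V} (hv : ¬v ∉ M₀.verts) : M₀.Adj v (m v) := by
    obtain ⟨w, hw, -⟩ := hM₀.1 (not_not.1 hv)
    rwa [hm.extend _ _ hw]
  refine ⟨⟨m, hm.invol, hm.ne, M₀, hM₀, hm.extend⟩, M₀.vertsᶜ, ?_, ?_, ?_, ?_, ?_⟩
  · exact fun r hr s hs => hM₀.not_adj hr hs
  · exact fun v hv => (mate_adj hv).adj_sub
  · intro v hv h
    have h1 := mate_adj (not_not.2 h)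
    rw [hm.invol] at h1
    exact hv h1.snd_mem
  · exact fun r hr s hs hrs a ha hra has => hM₀.not_augmenting hr hs hrs (mate_adj ha) hra has
  · exact fun r hr s hs => hex r s hr hs

end Matching

/-! ### Excluded 4-cycles and 6-cycles. -/

section ShortCycles

variable {V : Type*} {G : SimpleGraph V}

theorem not_four_cycle (h : (SimpleGraph.cycleGraph 4).Free G) {a b c d : V} (hab : G.Adj a b)
    (hbc : G.Adj b c) (hcd : G.Adj c d) (hda : G.Adj d a) (hac : a ≠ c) (hbd : b ≠ d) : False := by
  refine h ⟨⟨⟨![a, b, c, d], ?_⟩, ?_⟩⟩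
  · intro i j hij
    rw [SimpleGraph.cycleGraph_adj] at hij
    fin_cases i <;> fin_cases j <;> first
      | exact absurd hij (by decide)
      | simp [hab, hbc, hcd, hda, hab.symm, hbc.symm, hcd.symm, hda.symm]
  · intro i j hij
    have := hab.ne; have := hbc.ne; have := hcd.ne; have := hda.ne
    fin_cases i <;> fin_cases j <;> simp_all

theorem not_six_cycle (h : (SimpleGraph.cycleGraph 6).Free G) {a b c d e f : V} (hab : G.Adj a b)
    (hbc : G.Adj b c) (hcd : G.Adj c d) (hde : G.Adj d e) (hef : G.Adj e f) (hfa : G.Adj f a)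
    (hnd : [a, b, c, d, e, f].Nodup) : False := by
  refine h ⟨⟨⟨fun i : Fin 6 => [a, b, c, d, e, f].get i, ?_⟩, ?_⟩⟩
  · intro i j hij
    rw [SimpleGraph.cycleGraph_adj] at hij
    fin_cases i <;> fin_cases j <;> first
      | exact absurd hij (by decide)
      | simp [hab, hbc, hcd, hde, hef, hfa, hab.symm, hbc.symm, hcd.symm, hde.symm, hef.symm,
          hfa.symm]
  · exact List.nodup_iff_injective_get.1 hnd

end ShortCycles

end MaxBisection

/-! ### At most five pairs contribute with the same sign. -/

namespace MaxBisection

open Finset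

variable {V : Type*} {G : SimpleGraph V}

namespace QuasiPerfectMatching

variable (M : QuasiPerfectMatching G)

theorem mate_eq_iff {v w : V} : M.mate v = w ↔ v = M.mate w :=
  ⟨fun h => by rw [← h, M.mate_mate], fun h => by rw [h, M.mate_mate]⟩

theorem mate_inj {v w : V} : M.mate v = M.mate w ↔ v = w := by
  rw [mate_eq_iff, M.mate_mate]

/-- `v` is adjacent to `r` but not to the partner of `r`. -/
def SingleAdj (v r : V) : Prop := G.Adj v r ∧ ¬G.Adj v (M.mate r)

/-- `u'` is singly adjacent to `r` and `v` is singly adjacent to `r'`. -/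
def CrossAdj (u v r : V) : Prop := M.SingleAdj (M.mate u) r ∧ M.SingleAdj v (M.mate r)

/-- The coefficient with which the pair of `i` contributes to `σ(uu')`, up to sign: edges between
the pairs count `1` if they join `u` to `i` or `u'` to `i'`, and `-1` otherwise. -/
noncomputable def pairCoeff (u i : V) : ℤ :=
  open Classical in
  (if G.Adj u i then 1 else 0) - (if G.Adj (M.mate u) i then 1 else 0)
    - (if G.Adj u (M.mate i) then 1 else 0) + (if G.Adj (M.mate u) (M.mate i) then 1 else 0)

end QuasiPerfectMatching

namespace IsExchangeable

variable {M : QuasiPerfectMatching G} {W : Set V} (hM : IsExchangeable M W)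

include hM

/-- Two different pairs are not joined by two disjoint edges. -/
theorem not_disjoint_edges (hC : (SimpleGraph.cycleGraph 4).Free G) {u r : V}
    (hru' : r ≠ M.mate u) (h : G.Adj u r) : ¬G.Adj (M.mate u) (M.mate r) := fun h' => by
  -- Two missed pairs have no edge between them; one missed and one matched pair give an augmenting
  -- path with three edges; two matched pairs give a 4-cycle.
  by_cases hu : u ∈ W <;> by_cases hr : r ∈ W
  · exact hM.not_adj u hu r hr h
  · exact hM.not_augmenting u hu _ (hM.mate_mem u hu) (M.mate_ne u).symm r hr h h'.symm
  · exact hM.not_augmenting r hr _ (hM.mate_mem r hr) (M.mate_ne r).symm u hu h.symm h'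
  · exact not_four_cycle hC h (hM.adj_mate r hr) h'.symm (hM.adj_mate u hu).symm
      (fun e => hru' (M.mate_eq_iff.1 e.symm)) hru'

/-- As disjoint edges are excluded, two edges between the pairs share an endpoint and cancel. A
nonzero coefficient therefore comes from a single edge. -/
theorem pairCoeff_cases (hC : (SimpleGraph.cycleGraph 4).Free G) {u i : V} (hiu : i ≠ u)
    (hiu' : i ≠ M.mate u) :
    M.pairCoeff u i = 0
      ∨ M.pairCoeff u i = 1 ∧ (M.SingleAdj u i ∨ M.SingleAdj (M.mate u) (M.mate i))
      ∨ M.pairCoeff u i = -1 ∧ (M.SingleAdj u (M.mate i) ∨ M.SingleAdj (M.mate u) i) := by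
  have h1 := hM.not_disjoint_edges hC hiu'
  have h2 := hM.not_disjoint_edges hC (u := M.mate u) (r := i) (by rwa [M.mate_mate])
  rw [M.mate_mate] at h2
  unfold QuasiPerfectMatching.pairCoeff QuasiPerfectMatching.SingleAdj
  rw [M.mate_mate]
  by_cases a : G.Adj u i <;> by_cases b : G.Adj (M.mate u) i <;>
    by_cases c : G.Adj u (M.mate i) <;> by_cases d : G.Adj (M.mate u) (M.mate i) <;>
    simp_all

theorem exists_of_pairCoeff_mul_eq_one (hC : (SimpleGraph.cycleGraph 4).Free G) {u v i : V}
    (hiu : i ≠ u) (hiu' : i ≠ M.mate u) (hiv : i ≠ v) (hiv' : i ≠ M.mate v)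
    (h : M.pairCoeff u i * M.pairCoeff v i = 1) :
    ∃ r, (r = i ∨ r = M.mate i) ∧
      ((G.Adj u r ∧ G.Adj v r) ∨ (G.Adj (M.mate u) r ∧ G.Adj (M.mate v) r) ∨
        M.CrossAdj u v r ∨ M.CrossAdj v u r) := by
  unfold QuasiPerfectMatching.CrossAdj
  rcases hM.pairCoeff_cases hC hiu hiu' with h1 | ⟨h1, h1'⟩ | ⟨h1, h1'⟩
  · simp [h1] at h
  · rcases hM.pairCoeff_cases hC hiv hiv' with h2 | ⟨h2, h2'⟩ | ⟨h2, h2'⟩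
    · simp [h2] at h
    · rcases h1' with h1' | h1' <;> rcases h2' with h2' | h2'
      · exact ⟨i, Or.inl rfl, Or.inl ⟨h1'.1, h2'.1⟩⟩
      · refine ⟨M.mate i, Or.inr rfl, Or.inr (Or.inr (Or.inr ⟨h2', ?_⟩))⟩
        rwa [M.mate_mate]
      · refine ⟨M.mate i, Or.inr rfl, Or.inr (Or.inr (Or.inl ⟨h1', ?_⟩))⟩
        rwa [M.mate_mate]
      · exact ⟨M.mate i, Or.inr rfl, Or.inr (Or.inl ⟨h1'.1, h2'.1⟩)⟩
    · norm_num [h1, h2] at h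
  · rcases hM.pairCoeff_cases hC hiv hiv' with h2 | ⟨h2, h2'⟩ | ⟨h2, h2'⟩
    · simp [h2] at h
    · norm_num [h1, h2] at h
    · rcases h1' with h1' | h1' <;> rcases h2' with h2' | h2'
      · exact ⟨M.mate i, Or.inr rfl, Or.inl ⟨h1'.1, h2'.1⟩⟩
      · exact ⟨i, Or.inl rfl, Or.inr (Or.inr (Or.inr ⟨h2', h1'⟩))⟩
      · exact ⟨i, Or.inl rfl, Or.inr (Or.inr (Or.inl ⟨h1', h2'⟩))⟩
      · exact ⟨i, Or.inl rfl, Or.inr (Or.inl ⟨h1'.1, h2'.1⟩)⟩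

/-- The closed walk u', r, r', v, s', s is a 6-cycle, because `rr'` and `ss'` are edges. -/
theorem crossAdj_matched_unique (hC : (SimpleGraph.cycleGraph 6).Free G) {u v r s : V}
    (hvu' : v ≠ M.mate u) (hru : r ≠ u) (hrv : r ≠ v)
    (hsu : s ≠ u) (hsv : s ≠ v) (hsr : s ≠ r) (hsr' : s ≠ M.mate r)
    (hr : M.CrossAdj u v r) (hs : M.CrossAdj u v s) (hrW : r ∉ W) (hsW : s ∉ W) : False := by
  refine not_six_cycle hC hr.1.1 (hM.adj_mate r hrW) hr.2.1.symm hs.2.1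
    (hM.adj_mate s hsW).symm hs.1.1.symm ?_
  have h1 := hr.1.1.ne
  have h2 := hs.1.1.ne
  have h3 := M.mate_ne r
  have h4 := M.mate_ne s
  have h5 := hr.2.1.ne
  have h6 := hs.2.1.ne
  have e1 : M.mate u ≠ M.mate r := fun h => hru (M.mate_inj.1 h.symm)
  have e2 : M.mate u ≠ M.mate s := fun h => hsu (M.mate_inj.1 h.symm)
  have e3 : M.mate r ≠ M.mate s := fun h => hsr (M.mate_inj.1 h.symm)
  have e4 : r ≠ M.mate s := fun h => hsr' (M.mate_eq_iff.1 h.symm)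
  simp only [List.nodup_cons, List.mem_cons, List.not_mem_nil, not_or, or_false]
  refine ⟨⟨h1, e1, hvu'.symm, e2, h2⟩, ⟨h3.symm, hrv, e4, hsr.symm⟩, ⟨h5.symm, e3, hsr'.symm⟩,
    ⟨h6, hsv.symm⟩, h4, not_false, List.nodup_nil⟩

/-- A common neighbour x of r and r' would close the 6-cycle u', r, x, r', v, u. Here `uu'` is an
edge because u' is adjacent to the missed vertex r. Single adjacency keeps x apart from u' and v,
and `not_disjoint_edges` keeps it apart from u. -/
theorem crossAdj_not_hasCommonNbr (hC₄ : (SimpleGraph.cycleGraph 4).Free G)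
    (hC : (SimpleGraph.cycleGraph 6).Free G) {u v r : V} (huv : G.Adj u v)
    (hvu' : v ≠ M.mate u) (hru : r ≠ u) (hru' : r ≠ M.mate u) (hrv : r ≠ v) (hrv' : r ≠ M.mate v)
    (hr : M.CrossAdj u v r) (hrW : r ∈ W) : ¬HasCommonNbr G r (M.mate r) := by
  rintro ⟨x, hx, hx'⟩
  have hu'W : M.mate u ∉ W := fun h => hM.not_adj _ h _ hrW hr.1.1
  have huW : u ∉ W := fun h => hu'W (hM.mate_mem u h)
  have e1 : M.mate u ≠ M.mate r := fun h => hru (M.mate_inj.1 h.symm)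
  have e2 : u ≠ M.mate r := fun h => hru' (M.mate_eq_iff.1 h.symm)
  have x1 : x ≠ M.mate u := by
    rintro rfl
    exact hr.1.2 hx'.symm
  have x2 : x ≠ v := by
    rintro rfl
    exact hr.2.2 (by rw [M.mate_mate]; exact hx.symm)
  have x3 : x ≠ u := by
    rintro rfl
    have := hM.not_disjoint_edges hC₄ (u := M.mate x) (r := r) (by rwa [M.mate_mate]) hr.1.1
    rw [M.mate_mate] at this
    exact this hx'.symm
  refine not_six_cycle hC hr.1.1 hx hx'.symm hr.2.1.symm huv.symm (hM.adj_mate u huW) ?_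
  simp only [List.nodup_cons, List.mem_cons, List.not_mem_nil, not_or, or_false]
  exact ⟨⟨hr.1.1.ne, x1.symm, e1, hvu'.symm, M.mate_ne u⟩,
    ⟨hx.ne, (M.mate_ne r).symm, hrv, hru⟩, ⟨hx'.ne.symm, x2, x3⟩,
    ⟨hr.2.1.ne.symm, e2.symm⟩, huv.ne.symm, not_false, List.nodup_nil⟩

/-- Both r and s are adjacent to u', so the exchange property gives one of them a common neighbour
with its mate. -/
theorem crossAdj_unmatched_unique (hC₄ : (SimpleGraph.cycleGraph 4).Free G)
    (hC : (SimpleGraph.cycleGraph 6).Free G) {u v r s : V} (huv : G.Adj u v)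
    (hvu' : v ≠ M.mate u) (hru : r ≠ u) (hru' : r ≠ M.mate u) (hrv : r ≠ v) (hrv' : r ≠ M.mate v)
    (hsu : s ≠ u) (hsu' : s ≠ M.mate u) (hsv : s ≠ v) (hsv' : s ≠ M.mate v)
    (hsr : s ≠ r) (hsr' : s ≠ M.mate r)
    (hr : M.CrossAdj u v r) (hs : M.CrossAdj u v s) (hrW : r ∈ W) (hsW : s ∈ W) : False := by
  rcases hM.exchange r hrW s hsW hsr hsr' ⟨_, hr.1.1.symm, hs.1.1.symm⟩ with h | h
  · exact hM.crossAdj_not_hasCommonNbr hC₄ hC huv hvu' hru hru' hrv hrv' hr hrW h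
  · exact hM.crossAdj_not_hasCommonNbr hC₄ hC huv hvu' hsu hsu' hsv hsv' hs hsW h

/-- The path r, u', u, s' would be augmenting. -/
theorem crossAdj_opposite_unique {u v r s : V} (hsr' : s ≠ M.mate r)
    (hr : M.CrossAdj u v r) (hs : M.CrossAdj v u s) (hrW : r ∈ W) (hsW : s ∈ W) : False := by
  refine hM.not_augmenting r hrW (M.mate s) (hM.mate_mem s hsW)
    (fun h => hsr' (M.mate_eq_iff.1 h.symm)) (M.mate u)
    (fun h => hM.not_adj _ h _ hrW hr.1.1) hr.1.1.symm ?_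
  rw [M.mate_mate]
  exact hs.2.1

/-- At most five pairs contribute with the same sign to `σ(uu')` and `σ(vv')`. -/
theorem card_le_five (hC₄ : (SimpleGraph.cycleGraph 4).Free G)
    (hC : (SimpleGraph.cycleGraph 6).Free G) {u v : V} (huv : G.Adj u v) (hvu' : v ≠ M.mate u)
    {T : Finset V} (hT : ∀ i ∈ T, i ≠ u ∧ i ≠ M.mate u ∧ i ≠ v ∧ i ≠ M.mate v)
    (hTT : ∀ i ∈ T, ∀ j ∈ T, j ≠ M.mate i)
    (h : ∀ i ∈ T, M.pairCoeff u i * M.pairCoeff v i = 1) : T.card ≤ 5 := by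
  classical
  -- `T` meets each pair at most once, so distinct members of `S p` have witnesses in distinct
  -- pairs. It remains to show for five properties `p` that two such witnesses are impossible.
  let S (p : V → Prop) : Finset V := T.filter fun i => ∃ r, (r = i ∨ r = M.mate i) ∧ p r
  have hS (p : V → Prop) (hp : ∀ r s, (r ≠ u ∧ r ≠ M.mate u ∧ r ≠ v ∧ r ≠ M.mate v) →
      (s ≠ u ∧ s ≠ M.mate u ∧ s ≠ v ∧ s ≠ M.mate v) → s ≠ r → s ≠ M.mate r → p r → p s →
      False) : (S p).card ≤ 1 := by
    have ne {i r : V} (hi : i ∈ T) (hr : r = i ∨ r = M.mate i) :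
        r ≠ u ∧ r ≠ M.mate u ∧ r ≠ v ∧ r ≠ M.mate v := by
      obtain ⟨h1, h2, h3, h4⟩ := hT i hi
      rcases hr with rfl | rfl
      · exact ⟨h1, h2, h3, h4⟩
      · simp only [ne_eq, M.mate_eq_iff, M.mate_mate]
        exact ⟨h2, h1, h4, h3⟩
    refine Finset.card_le_one.2 fun i hi j hj => ?_
    obtain ⟨hi, r, hir, hr⟩ := Finset.mem_filter.1 hi
    obtain ⟨hj, s, hjs, hs⟩ := Finset.mem_filter.1 hj
    by_contra hij
    have hij' := hTT i hi j hj
    refine hp r s (ne hi hir) (ne hj hjs) ?_ ?_ hr hs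
    · rcases hir with rfl | rfl <;> rcases hjs with rfl | rfl
      · exact fun h => hij h.symm
      · exact fun h => hij' (M.mate_eq_iff.1 h)
      · exact hij'
      · exact fun h => hij (M.mate_inj.1 h.symm)
    · rcases hir with rfl | rfl <;> rcases hjs with rfl | rfl
      · exact hij'
      · exact fun h => hij (M.mate_inj.1 h.symm)
      · rw [M.mate_mate]; exact fun h => hij h.symm
      · rw [M.mate_mate]; exact fun h => hij' (M.mate_eq_iff.1 h)
  have huv' : u ≠ M.mate v := fun h => hvu' (M.mate_eq_iff.1 h.symm)
  have c1 : (S fun r => G.Adj u r ∧ G.Adj v r).card ≤ 1 := hS _ fun r s _ _ hsr _ hr hs =>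
    not_four_cycle hC₄ hr.1 hr.2.symm hs.2 hs.1.symm huv.ne hsr.symm
  have c2 : (S fun r => G.Adj (M.mate u) r ∧ G.Adj (M.mate v) r).card ≤ 1 :=
    hS _ fun r s _ _ hsr _ hr hs =>
      not_four_cycle hC₄ hr.1 hr.2.symm hs.2 hs.1.symm (fun h => huv.ne (M.mate_inj.1 h)) hsr.symm
  have c3 : (S fun r => M.CrossAdj u v r ∧ r ∉ W).card ≤ 1 :=
    hS _ fun r s nr ns hsr hsr' hr hs =>
      hM.crossAdj_matched_unique hC hvu' nr.1 nr.2.2.1 ns.1 ns.2.2.1 hsr hsr'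
        hr.1 hs.1 hr.2 hs.2
  have c4 : (S fun r => M.CrossAdj v u r ∧ r ∉ W).card ≤ 1 :=
    hS _ fun r s nr ns hsr hsr' hr hs =>
      hM.crossAdj_matched_unique hC huv' nr.2.2.1 nr.1 ns.2.2.1 ns.1 hsr hsr'
        hr.1 hs.1 hr.2 hs.2
  have c5 : (S fun r => (M.CrossAdj u v r ∨ M.CrossAdj v u r) ∧ r ∈ W).card ≤ 1 := by
    refine hS _ fun r s nr ns hsr hsr' hr hs => ?_
    rcases hr with ⟨hr | hr, hrW⟩ <;> rcases hs with ⟨hs | hs, hsW⟩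
    · exact hM.crossAdj_unmatched_unique hC₄ hC huv hvu' nr.1 nr.2.1 nr.2.2.1 nr.2.2.2 ns.1 ns.2.1
        ns.2.2.1 ns.2.2.2 hsr hsr' hr hs hrW hsW
    · exact hM.crossAdj_opposite_unique hsr' hr hs hrW hsW
    · exact hM.crossAdj_opposite_unique hsr' hr hs hrW hsW
    · exact hM.crossAdj_unmatched_unique hC₄ hC huv.symm huv' nr.2.2.1 nr.2.2.2 nr.1 nr.2.1
        ns.2.2.1 ns.2.2.2 ns.1 ns.2.1 hsr hsr' hr hs hrW hsW
  have cover : T ⊆ (S fun r => G.Adj u r ∧ G.Adj v r) ∪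
      ((S fun r => G.Adj (M.mate u) r ∧ G.Adj (M.mate v) r) ∪
      ((S fun r => M.CrossAdj u v r ∧ r ∉ W) ∪ ((S fun r => M.CrossAdj v u r ∧ r ∉ W) ∪
      S fun r => (M.CrossAdj u v r ∨ M.CrossAdj v u r) ∧ r ∈ W))) := by
    intro i hi
    obtain ⟨h1, h2, h3, h4⟩ := hT i hi
    obtain ⟨r, hir, hr⟩ := hM.exists_of_pairCoeff_mul_eq_one hC₄ h1 h2 h3 h4 (h i hi)
    have mem (p : V → Prop) (hp : p r) : i ∈ S p := Finset.mem_filter.2 ⟨hi, r, hir, hp⟩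
    simp only [Finset.mem_union]
    by_cases hrW : r ∈ W
    · rcases hr with hr | hr | hr
      · exact Or.inl (mem _ hr)
      · exact Or.inr (Or.inl (mem _ hr))
      · exact Or.inr (Or.inr (Or.inr (Or.inr (mem _ ⟨hr, hrW⟩))))
    · rcases hr with hr | hr | hr | hr
      · exact Or.inl (mem _ hr)
      · exact Or.inr (Or.inl (mem _ hr))
      · exact Or.inr (Or.inr (Or.inl (mem _ ⟨hr, hrW⟩)))
      · exact Or.inr (Or.inr (Or.inr (Or.inl (mem _ ⟨hr, hrW⟩))))
  refine (Finset.card_le_card cover).trans ((Finset.card_union_le _ _).trans ?_)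
  refine (Nat.add_le_add c1 ((Finset.card_union_le _ _).trans (Nat.add_le_add c2
    ((Finset.card_union_le _ _).trans (Nat.add_le_add c3 ((Finset.card_union_le _ _).trans
      (Nat.add_le_add c4 c5))))))).trans (by norm_num)

end IsExchangeable

end MaxBisection

/-! ### From the two-stage algorithm to signed sums. -/

namespace MaxBisection

open Finset
open scoped BigOperators

theorem sum_ind {α : Type*} [Fintype α] (p : α → Prop) [Fintype {x // p x}] :
    ∑ x, ind (p x) = (Fintype.card {x // p x} : ℝ) := by
  classical
  rw [Fintype.card_subtype, Finset.card_filter, Nat.cast_sum]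
  refine Finset.sum_congr rfl fun x _ => ?_
  by_cases h : p x <;> simp [ind, h]

/-- Conditioning on the labels of two pairs joined by a single edge. -/
theorem expect_cut_eq {ι : Type*} [Fintype ι] [DecidableEq ι] {i j : ι} (hij : i ≠ j)
    {a b : ι → ℤ} (hai : a i = 0) (haj : a j = 0) (hbi : b i = 0) (hbj : b j = 0) :
    𝔼 x : ι → Bool, (1 / 2 + (ind (x i ≠ x j) - 1 / 2)
        * ind (0 ≤ -boolSign (x i) * (boolSign (x j) + signSum univ a x)
            ∧ 0 ≤ -boolSign (x j) * (boolSign (x i) + signSum univ b x)))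
      = 1 / 2 + 1 / 4 * 𝔼 x : ι → Bool, (ind (signSum univ a x ≤ 1 ∧ -1 ≤ signSum univ b x)
          - ind (signSum univ a x ≤ -1 ∧ signSum univ b x ≤ -1)) := by
  have upd {c : ι → ℤ} {k : ι} (hc : c k = 0) (x : ι → Bool) (β : Bool) :
      signSum univ c (Function.update x k β) = signSum univ c x := by
    refine Finset.sum_congr rfl fun l _ => ?_
    by_cases h : l = k
    · subst h; simp [hc]
    · rw [Function.update_of_ne h]
  rw [expect_eq_expect_update i, expect_eq_expect_update j]
  simp only [upd hai, upd haj, upd hbi, upd hbj, Function.update_self,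
    Function.update_of_ne hij.symm]
  -- The four label patterns of the two pairs, each of weight 1/4. Two of the resulting terms have A
  -- and B negated; complementing all labels (`sym`) identifies them with the other two.
  have e (A B : ℤ) : ((1 / 2 + (ind (true ≠ true) - 1 / 2)
        * ind (0 ≤ -boolSign true * (boolSign true + A) ∧ 0 ≤ -boolSign true * (boolSign true + B))
      + (1 / 2 + (ind (false ≠ true) - 1 / 2)
        * ind (0 ≤ -boolSign false * (boolSign true + A)
          ∧ 0 ≤ -boolSign true * (boolSign false + B)))) / 2
      + (1 / 2 + (ind (true ≠ false) - 1 / 2)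
        * ind (0 ≤ -boolSign true * (boolSign false + A)
          ∧ 0 ≤ -boolSign false * (boolSign true + B))
      + (1 / 2 + (ind (false ≠ false) - 1 / 2)
        * ind (0 ≤ -boolSign false * (boolSign false + A)
          ∧ 0 ≤ -boolSign false * (boolSign false + B)))) / 2) / 2
      = 1 / 2 + 1 / 8 * (ind (A ≤ 1 ∧ -1 ≤ B) - ind (A ≤ -1 ∧ B ≤ -1)
        + (ind (-A ≤ 1 ∧ -1 ≤ -B) - ind (-A ≤ -1 ∧ -B ≤ -1))) := by
    rw [ind_of_not (show ¬(true ≠ true) by decide), ind_of (show false ≠ true by decide),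
      ind_of (show true ≠ false by decide), ind_of_not (show ¬(false ≠ false) by decide)]
    simp only [boolSign_true, boolSign_false]
    rw [ind_congr (show 0 ≤ -1 * (1 + A) ∧ 0 ≤ -1 * (1 + B) ↔ A ≤ -1 ∧ B ≤ -1 by omega),
      ind_congr (show 0 ≤ - -1 * (1 + A) ∧ 0 ≤ -1 * (-1 + B) ↔ -A ≤ 1 ∧ -1 ≤ -B by omega),
      ind_congr (show 0 ≤ -1 * (-1 + A) ∧ 0 ≤ - -1 * (1 + B) ↔ A ≤ 1 ∧ -1 ≤ B by omega),
      ind_congr (show 0 ≤ - -1 * (-1 + A) ∧ 0 ≤ - -1 * (-1 + B) ↔ -A ≤ -1 ∧ -B ≤ -1 by omega)]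
    ring
  simp only [e]
  have sym := expect_compl (ι := ι) fun x => ind (signSum univ a x ≤ 1 ∧ -1 ≤ signSum univ b x)
          - ind (signSum univ a x ≤ -1 ∧ signSum univ b x ≤ -1)
  simp only [signSum_compl] at sym
  rw [Finset.expect_add_distrib, Fintype.expect_const, ← Finset.mul_expect,
    Finset.expect_add_distrib, sym]
  ring

namespace QuasiPerfectMatching

section Transversal

variable {V : Type*} {G : SimpleGraph V} (M : QuasiPerfectMatching G)

/-- `D` contains exactly one vertex of each pair. -/
def IsTransversal (D : Finset V) : Prop := ∀ v, M.mate v ∈ D ↔ v ∉ D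

theorem exists_isTransversal [Fintype V] {u v : V} (hvu' : v ≠ M.mate u) :
    ∃ D, M.IsTransversal D ∧ u ∈ D ∧ v ∈ D := by
  classical
  let e := Fintype.equivFin V
  have huv' : u ≠ M.mate v := fun h => hvu' (M.mate_eq_iff.1 h.symm)
  refine ⟨univ.filter fun a => a = u ∨ a = v ∨
    (a ≠ M.mate u ∧ a ≠ M.mate v ∧ e a < e (M.mate a)), fun a => ?_, by simp, by simp⟩
  simp only [mem_filter, mem_univ, true_and, M.mate_mate, ne_eq, M.mate_inj]
  rw [M.mate_eq_iff, M.mate_eq_iff]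
  have hne : e (M.mate a) ≠ e a := fun h => M.mate_ne a (e.injective h)
  by_cases h1 : a = u
  · subst h1
    simp [(M.mate_ne a).symm, huv']
  by_cases h2 : a = v
  · subst h2
    simp [(M.mate_ne a).symm, hvu']
  by_cases h3 : a = M.mate u
  · simp [h3, M.mate_ne, hvu'.symm]
  by_cases h4 : a = M.mate v
  · simp [h4, M.mate_ne, huv'.symm]
  simp only [h1, h2, h3, h4, false_or, not_false_eq_true, true_and, not_lt]
  exact ⟨le_of_lt, fun h => lt_of_le_of_ne h hne⟩

variable {M} {D : Finset V} (hD : M.IsTransversal D)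

include hD

/-- A splitting is determined by its labels on a transversal, which are arbitrary. -/
def IsTransversal.splittingEquiv [DecidableEq V] : M.Splitting ≃ (D → Bool) where
  toFun h i := h.1 i
  invFun x := ⟨fun a => if ha : a ∈ D then x ⟨a, ha⟩ else !x ⟨M.mate a, (hD a).2 ha⟩, fun a => by
    by_cases ha : a ∈ D
    · have ha' : M.mate a ∉ D := fun h => (hD a).1 h ha
      simp [ha, ha', M.mate_mate]
    · have ha' : M.mate a ∈ D := (hD a).2 ha
      simp [ha, ha']⟩
  left_inv h := by
    ext a
    by_cases ha : a ∈ D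
    · simp [ha]
    · simp [ha, h.2]
  right_inv x := by
    funext i
    simp

theorem IsTransversal.sum_eq [Fintype V] {R : Type*} [AddCommMonoid R] (f : V → R) :
    ∑ w, f w = ∑ i : D, (f i + f (M.mate i)) := by
  classical
  rw [← Finset.sum_add_sum_compl D f, Finset.sum_add_distrib, Finset.sum_coe_sort D f,
    Finset.sum_coe_sort D fun i => f (M.mate i)]
  congr 1
  refine Finset.sum_nbij' M.mate M.mate (fun a ha => ?_) (fun a ha => ?_)
    (fun a _ => M.mate_mate a) (fun a _ => M.mate_mate a) fun a _ => by rw [M.mate_mate]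
  · exact (hD a).2 (by simpa using ha)
  · simpa using fun h => (hD a).1 h ha

end Transversal

section Sigma

variable {V : Type*} [Fintype V] [DecidableEq V] {G : SimpleGraph V} [DecidableRel G.Adj]
  {M : QuasiPerfectMatching G}

theorem card_labelNbrs_sub (h : V → Bool) (a : V) :
    ((M.labelNbrs h (!h a) a).card : ℤ) - ((M.labelNbrs h (h a) a).card : ℤ)
      = -boolSign (h a)
        * ∑ w, (if G.Adj a w ∧ w ≠ M.mate a then 1 else 0) * boolSign (h w) := by
  have card_eq (β : Bool) : ((M.labelNbrs h β a).card : ℤ)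
      = ∑ w, if G.Adj a w ∧ w ≠ M.mate a ∧ h w = β then 1 else 0 := by
    rw [labelNbrs, SimpleGraph.neighborFinset_eq_filter, Finset.filter_filter, Finset.card_filter]
    push_cast
    rfl
  rw [card_eq, card_eq, ← Finset.sum_sub_distrib, Finset.mul_sum]
  refine Finset.sum_congr rfl fun w _ => ?_
  by_cases h1 : G.Adj a w <;> by_cases h2 : w = M.mate a <;> cases h a <;> cases h w <;>
    simp [h1, h2]

/-- Mates carry opposite labels, so the up to four edges between two pairs merge into one
coefficient times the label of the representative in `D`. -/
theorem sigma_eq {D : Finset V} (hD : M.IsTransversal D) (h : M.Splitting) {u : V} (hu : u ∈ D) :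
    M.sigma h.1 u = -boolSign (h.1 u)
      * ∑ i : D, (if (i : V) = u then 0 else M.pairCoeff u i) * boolSign (h.1 i) := by
  have h1 := card_labelNbrs_sub (M := M) h.1 u
  have h2 := card_labelNbrs_sub (M := M) h.1 (M.mate u)
  have h3 : M.sigma h.1 u = -boolSign (h.1 u)
      * ∑ w, ((if G.Adj u w ∧ w ≠ M.mate u then 1 else 0)
        - (if G.Adj (M.mate u) w ∧ w ≠ u then 1 else 0)) * boolSign (h.1 w) := by
    simp only [sub_mul, Finset.sum_sub_distrib]
    rw [M.mate_mate, h.2, boolSign_not] at h2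
    unfold sigma
    rw [h.2]
    linarith
  rw [h3, hD.sum_eq]
  congr 1
  refine Finset.sum_congr rfl fun i _ => ?_
  rw [h.2, boolSign_not]
  have hi' : (i : V) ≠ M.mate u := fun e => (hD u).1 (e ▸ i.2) hu
  by_cases hi : (i : V) = u
  · simp [hi]
  · have e1 : M.mate i ≠ u := fun e => hi' (M.mate_eq_iff.1 e)
    have e2 : M.mate i ≠ M.mate u := fun e => hi (M.mate_inj.1 e)
    simp only [hi, hi', e1, e2, ne_eq, not_false_eq_true, and_true, if_false, pairCoeff]
    ring_nf

theorem cutProb_eq_expect (u v : V) :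
    M.cutProb u v = 𝔼 h : M.Splitting, 𝔼 g : M.Splitting,
      ind ((M.relabel h g).1 u ≠ (M.relabel h g).1 v) := by
  classical
  have hms : MeasurableSet {h' : M.Splitting | h'.1 u ≠ h'.1 v} := Set.Finite.measurableSet
    (Set.toFinite _)
  rw [cutProb, MeasureTheory.measureReal_def, twoStage, PMF.toMeasure_bind_apply _ _ _ hms,
    tsum_fintype, ENNReal.toReal_sum]
  · rw [Finset.expect_eq_sum_div_card, Finset.sum_div]
    refine Finset.sum_congr rfl fun h _ => ?_
    rw [PMF.toMeasure_map_apply _ _ _ (measurable_of_finite _) hms, fairChoices,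
      PMF.toMeasure_uniformOfFintype_apply _ (Set.Finite.measurableSet (Set.toFinite _)),
      PMF.uniformOfFintype_apply, ENNReal.toReal_mul, ENNReal.toReal_div,
      Finset.expect_eq_sum_div_card]
    have hcard : ∑ g, ind ((M.relabel h g).1 u ≠ (M.relabel h g).1 v)
        = (Fintype.card ((fun g => M.relabel h g) ⁻¹' {h' | h'.1 u ≠ h'.1 v}) : ℝ) :=
      sum_ind fun g => g ∈ (fun g => M.relabel h g) ⁻¹' {h' | h'.1 u ≠ h'.1 v}
    simp only [ENNReal.toReal_inv, ENNReal.toReal_natCast, hcard, Finset.card_univ]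
    field_simp
  · intro h _
    exact ENNReal.mul_ne_top (PMF.apply_ne_top _ _) (MeasureTheory.measure_ne_top _ _)

/-- As u and v represent different pairs, the fresh label of an active one is fair and independent
of the final label of the other, so the two differ with probability 1/2. -/
theorem expect_relabel_eq {D : Finset V} (hD : M.IsTransversal D) (h : M.Splitting) {u v : V}
    (hu : u ∈ D) (hv : v ∈ D) (huv : u ≠ v) :
    𝔼 g : M.Splitting, ind ((M.relabel h g).1 u ≠ (M.relabel h g).1 v)
      = 1 / 2 + (ind (h.1 u ≠ h.1 v) - 1 / 2) * ind (0 ≤ M.sigma h.1 u ∧ 0 ≤ M.sigma h.1 v) := by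
  have hne : (⟨u, hu⟩ : D) ≠ ⟨v, hv⟩ := fun e => huv (congrArg Subtype.val e)
  have half (c : Bool) : (ind (true ≠ c) + ind (false ≠ c)) / 2 = 1 / 2 := by
    cases c <;> simp [ind]
  have half' (c : Bool) : (ind (c ≠ true) + ind (c ≠ false)) / 2 = 1 / 2 := by
    cases c <;> simp [ind]
  have tr : 𝔼 g : M.Splitting, ind ((M.relabel h g).1 u ≠ (M.relabel h g).1 v)
      = 𝔼 x : D → Bool, ind ((if M.sigma h.1 u < 0 then x ⟨u, hu⟩ else h.1 u)
          ≠ (if M.sigma h.1 v < 0 then x ⟨v, hv⟩ else h.1 v)) :=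
    Fintype.expect_equiv hD.splittingEquiv _ _ fun g => rfl
  rw [tr]
  by_cases h1 : M.sigma h.1 u < 0
  · rw [ind_of_not (p := 0 ≤ M.sigma h.1 u ∧ _) (fun h' => absurd h1 (not_lt.2 h'.1)),
      expect_eq_expect_update ⟨u, hu⟩]
    simp only [h1, if_true, Function.update_self, Function.update_of_ne hne.symm, half,
      Fintype.expect_const]
    ring
  by_cases h2 : M.sigma h.1 v < 0
  · rw [ind_of_not (p := _ ∧ 0 ≤ M.sigma h.1 v) (fun h' => absurd h2 (not_lt.2 h'.2)),
      expect_eq_expect_update ⟨v, hv⟩]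
    simp only [h1, h2, if_true, if_false, Function.update_self, half', Fintype.expect_const]
    ring
  · rw [ind_of (p := 0 ≤ M.sigma h.1 u ∧ _) ⟨not_lt.1 h1, not_lt.1 h2⟩]
    simp only [h1, h2, if_false, Fintype.expect_const]
    ring

/-- Each counted pair receives at least one edge from `{u, u'}`. The edge `uv` is left out of the
count and supplies the `+ 1` that the walk estimate needs. -/
theorem card_pairCoeff_ne_zero_lt {D : Finset V} (hD : M.IsTransversal D) {u v : V} (hv : v ∈ D)
    (huv : G.Adj u v) :
    (univ.filter fun i : D => (if (i : V) = u ∨ (i : V) = v then 0 else M.pairCoeff u i) ≠ 0).card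
      + 1 ≤ G.degree u + G.degree (M.mate u) := by
  classical
  have e : G.degree u + G.degree (M.mate u)
      = ∑ w, ((if G.Adj u w then 1 else 0) + (if G.Adj (M.mate u) w then 1 else 0)) := by
    rw [Finset.sum_add_distrib, Finset.sum_boole, Finset.sum_boole,
      ← SimpleGraph.card_neighborFinset_eq_degree, ← SimpleGraph.card_neighborFinset_eq_degree,
      SimpleGraph.neighborFinset_eq_filter, SimpleGraph.neighborFinset_eq_filter]
    simp
  have hmem : (⟨v, hv⟩ : D) ∉ univ.filter fun i : D =>
      (if (i : V) = u ∨ (i : V) = v then 0 else M.pairCoeff u i) ≠ 0 := by simp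
  rw [e, hD.sum_eq, ← Finset.card_insert_of_notMem hmem, Finset.card_eq_sum_ones]
  refine (Finset.sum_le_sum fun i hi => ?_).trans
    (Finset.sum_le_sum_of_subset (Finset.subset_univ _))
  rcases Finset.mem_insert.1 hi with rfl | hi
  · simp only [huv, if_true]; omega
  · have hi := (Finset.mem_filter.1 hi).2
    by_contra hlt
    apply hi
    have h0 : ¬G.Adj u i ∧ ¬G.Adj (M.mate u) i ∧ ¬G.Adj u (M.mate i)
        ∧ ¬G.Adj (M.mate u) (M.mate i) := by
      refine ⟨?_, ?_, ?_, ?_⟩ <;> intro h <;> apply hlt <;> simp only [h, if_true] <;> omega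
    simp [pairCoeff, h0.1, h0.2.1, h0.2.2.1, h0.2.2.2]

end Sigma

end QuasiPerfectMatching

theorem IsExchangeable.cutProb_ge {V : Type*} [Fintype V] [DecidableEq V] {G : SimpleGraph V}
    [DecidableRel G.Adj] {M : QuasiPerfectMatching G} {W : Set V} (hM : IsExchangeable M W)
    (hC₄ : (SimpleGraph.cycleGraph 4).Free G) (hC₆ : (SimpleGraph.cycleGraph 6).Free G)
    {u v : V} (huv : G.Adj u v) (hvu' : v ≠ M.mate u)
    (h : G.interedges {u, M.mate u} {v, M.mate v} = {(u, v)}) :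
    1 / 2 + 1 / 1024 * (1 / √((G.degree u : ℝ) + (G.degree (M.mate u) : ℝ))
        + 1 / √((G.degree v : ℝ) + (G.degree (M.mate v) : ℝ))) ≤ M.cutProb u v := by
  obtain ⟨D, hD, hu, hv⟩ := M.exists_isTransversal hvu'
  have huv' : u ≠ M.mate v := fun h => hvu' (M.mate_eq_iff.1 h.symm)
  have hmem (a b : V) : (a, b) ∈ G.interedges {u, M.mate u} {v, M.mate v} ↔ (a, b) = (u, v) := by
    rw [h, Finset.mem_singleton]
  simp only [SimpleGraph.mem_interedges_iff, Finset.mem_insert, Finset.mem_singleton,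
    Prod.mk.injEq] at hmem
  have n1 : ¬G.Adj (M.mate u) v := fun h' =>
    M.mate_ne u ((hmem _ _).1 ⟨Or.inr rfl, Or.inl rfl, h'⟩).1
  have n2 : ¬G.Adj u (M.mate v) := fun h' =>
    M.mate_ne v ((hmem _ _).1 ⟨Or.inl rfl, Or.inr rfl, h'⟩).2
  have n3 : ¬G.Adj (M.mate u) (M.mate v) := fun h' =>
    M.mate_ne u ((hmem _ _).1 ⟨Or.inr rfl, Or.inr rfl, h'⟩).1
  have puv : M.pairCoeff u v = 1 := by
    simp [QuasiPerfectMatching.pairCoeff, huv, n1, n2, n3]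
  have pvu : M.pairCoeff v u = 1 := by
    simp [QuasiPerfectMatching.pairCoeff, huv.symm, G.adj_comm _ u, G.adj_comm _ (M.mate u), n1,
      n2, n3]
  have notMate {i : D} {a : V} (ha : a ∈ D) : (i : V) ≠ M.mate a := fun e =>
    (hD a).1 (e ▸ i.2) ha
  let iu : D := ⟨u, hu⟩
  let iv : D := ⟨v, hv⟩
  have hne : iu ≠ iv := fun e => huv.ne (congrArg Subtype.val e)
  -- Both coefficient vectors vanish at u and v: the labels of these two enter separately, each with
  -- coefficient 1 in the other's sum.
  let a : D → ℤ := fun i => if (i : V) = u ∨ (i : V) = v then 0 else M.pairCoeff u i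
  let b : D → ℤ := fun i => if (i : V) = v ∨ (i : V) = u then 0 else M.pairCoeff v i
  have coeff {u v : V} (hu : u ∈ D) (hv : v ∈ D) (huv : G.Adj u v) (p : M.pairCoeff u v = 1)
      (x : D → Bool) :
      ∑ i : D, (if (i : V) = u then 0 else M.pairCoeff u i) * boolSign (x i)
        = boolSign (x ⟨v, hv⟩) + signSum univ
          (fun i : D => if (i : V) = u ∨ (i : V) = v then 0 else M.pairCoeff u i) x := by
    rw [signSum, ← Finset.add_sum_erase univ _ (Finset.mem_univ (⟨v, hv⟩ : D)),
      ← Finset.add_sum_erase univ (fun i : D => _ * boolSign (x i))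
        (Finset.mem_univ (⟨v, hv⟩ : D))]
    simp only [huv.ne.symm, if_false, p, or_true, if_true, one_mul, zero_mul, zero_add]
    congr 1
    refine Finset.sum_congr rfl fun i hi => ?_
    have : (i : V) ≠ v := fun e => (Finset.mem_erase.1 hi).1 (Subtype.ext e)
    simp [this]
  have hcut : M.cutProb u v = 1 / 2 + 1 / 4 * 𝔼 x : D → Bool,
      (ind (signSum univ a x ≤ 1 ∧ -1 ≤ signSum univ b x)
        - ind (signSum univ a x ≤ -1 ∧ signSum univ b x ≤ -1)) := by
    rw [M.cutProb_eq_expect, ← expect_cut_eq hne (by simp [a, iu]) (by simp [a, iv])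
      (by simp [b, iu]) (by simp [b, iv])]
    refine Fintype.expect_equiv hD.splittingEquiv _ _ fun h => ?_
    rw [QuasiPerfectMatching.expect_relabel_eq hD h hu hv huv.ne,
      QuasiPerfectMatching.sigma_eq hD h hu, QuasiPerfectMatching.sigma_eq hD h hv]
    have c1 := coeff hu hv huv puv (hD.splittingEquiv h)
    have c2 := coeff hv hu huv.symm pvu (hD.splittingEquiv h)
    rw [← c1, ← c2]
    rfl
  have cases' {u v : V} (hu : u ∈ D) (i : D) :
      (if (i : V) = u ∨ (i : V) = v then 0 else M.pairCoeff u i) = 0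
        ∨ (if (i : V) = u ∨ (i : V) = v then 0 else M.pairCoeff u i) = 1
        ∨ (if (i : V) = u ∨ (i : V) = v then 0 else M.pairCoeff u i) = -1 := by
    by_cases hi : (i : V) = u ∨ (i : V) = v
    · simp [hi]
    · simp only [hi, if_false]
      exact (hM.pairCoeff_cases hC₄ (not_or.1 hi).1 (notMate hu)).imp_right
        (Or.imp And.left And.left)
  have hfive : (univ.filter fun i => a i * b i = 1).card ≤ 5 := by
    rw [← Finset.card_image_of_injective _ Subtype.val_injective]
    have hi {i : D} (hi : a i * b i = 1) : (i : V) ≠ u ∧ (i : V) ≠ v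
        ∧ M.pairCoeff u i * M.pairCoeff v i = 1 := by
      by_cases h1 : (i : V) = u
      · simp [a, h1] at hi
      by_cases h2 : (i : V) = v
      · simp [a, h2] at hi
      simp only [a, b, h1, h2, or_self, if_false] at hi
      exact ⟨h1, h2, hi⟩
    refine hM.card_le_five hC₄ hC₆ huv hvu' ?_ ?_ ?_
    all_goals
      simp only [Finset.forall_mem_image, Finset.mem_filter, Finset.mem_univ, true_and]
    · exact fun i h' => ⟨(hi h').1, notMate hu, (hi h').2.1, notMate hv⟩
    · exact fun i _ j _ => notMate i.2
    · exact fun i h' => (hi h').2.2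
  have key := cut_excess_ge (a := a) (b := b) (cases' hu) (cases' hv) hfive
    (QuasiPerfectMatching.card_pairCoeff_ne_zero_lt hD hv huv)
    (QuasiPerfectMatching.card_pairCoeff_ne_zero_lt hD hu huv.symm)
  push_cast at key
  rw [hcut]
  linarith

end MaxBisection

theorem lemma2p1 :
    ∃ ε : ℝ, 0 < ε ∧
      ∀ (V : Type*) [Fintype V] [DecidableEq V] (G : SimpleGraph V) [DecidableRel G.Adj],
        (SimpleGraph.cycleGraph 4).Free G → (SimpleGraph.cycleGraph 6).Free G →
        Even (Fintype.card V) → (∀ v, 2 ≤ G.degree v) →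
        ∃ M : MaxBisection.QuasiPerfectMatching G,
          ∀ u v : V, G.Adj u v → v ≠ M.mate u →
            G.interedges {u, M.mate u} {v, M.mate v} = {(u, v)} →
            1 / 2 + ε * (1 / √((G.degree u : ℝ) + (G.degree (M.mate u) : ℝ))
                + 1 / √((G.degree v : ℝ) + (G.degree (M.mate v) : ℝ)))
              ≤ M.cutProb u v := by
  -- 1024 = 4 · 64 · 4: the labels of u and v, the walk of at most five steps, and the excess
  -- estimate of `signCdf_one_ge`.
  refine ⟨1 / 1024, by norm_num, fun V _ _ G _ hC₄ hC₆ hV _ => ?_⟩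
  obtain ⟨M, W, hM⟩ := MaxBisection.exists_isExchangeable G hV
  exact ⟨M, fun u v huv hvu' h => hM.cutProb_ge hC₄ hC₆ huv hvu' h⟩
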